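/- **Theorem 3 (mean downlink rate).** *Network.* On $\mathbb R^2$ let $\Phi_m$ (master BSs, MBSs), $\Phi_s$ (slave BSs, SBSs) and $\Phi_u$ (UEs) be independent homogeneous Poisson processes with densities $\lambda_m,\lambda_s,\lambda_u>0$; a UE is a downlink (DL) UE with probability $\eta$, independently, and an uplink (UL) UE otherwise. A typical DL UE sits at the origin. A link of length $d$ between two devices has path loss $L=d^{\alpha_l}$ with probability $p_{\rm LOS}\mathbf 1(d\le d_{\rm LOS})$ and $L=d^{\alpha_n}$ otherwise, independently over pairs of devices. Transmit powers are $P_k$, main and side lobe gains $G_k,g_k$, beam widths $\Delta_k$ ($k\in\{m,s,u\}$). A UE at $Z$ is served by the BS that maximizes $P_tG_tB_t/L$ over both tiers $t\in\{m,s\}$, and an SBS by the MBS of smallest path loss. $X^*$ serves the origin, and $X^{**}$ is the MBS serving $X^*$ if $X^*\in\Phi_s$; $\mathcal E_t=\{X^*\in\Phi_t\}$, $\mathcal A_t=\mathbb P(\mathcal E_t)$. The power received at $X$ from $Y$ in slot $i$ is $C_0P_Yh_{i,X,Y}G_{i,X,Y}/L(X,Y)$, where $h$ is $\mathrm{Exp}(1)$;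 $G_{i,X,Y}$ is the product of the main lobe gains on a desired link, and on an interfering link the product of two independent gains, each equal to $G_k$ with probability $\Delta_k/2\pi$ and to $g_k$ otherwise. Fading and gains are independent over pairs of devices (arbitrarily correlated over slots) and of each other. Noise power is $\sigma^2>0$. *Loads (independent load model).* With $\epsilon_t=\lambda_u\mathcal A_t/\lambda_t$ let $$\Upsilon_t(n_1,n_2,k)=\frac{3.5^{3.5}}{\Gamma(3.5)}\frac{\eta^{n_2}(1-\eta)^{n_1}}{n_1!\,n_2!}\frac{\Gamma(n_1+n_2+k)}{\epsilon_t^k(1+3.5/\epsilon_t)^{n_1+n_2+k}},\qquad \kappa^*_\epsilon(n)=\frac{3.5^{3.5}\,\Gamma(n+3.5)\,\epsilon^{n-1}(3.5+\epsilon)^{-n-3.5}}{(n-1)!\,\Gamma(3.5)}\ (n\ge1),$$ $$\kappa_\epsilon(n)=\frac{3.5^{3.5}\,\Gamma(n+3.5)\,\epsilon^{n}(3.5+\epsilon)^{-n-3.5}}{n!\,\Gamma(3.5)}\ (n\ge0),\qquad \epsilon_{s,d}=\frac{\lambda_s}{\lambda_m}\Big(1-\Big(1+\tfrac{\mathcal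 A_s\lambda_u\eta}{3.5\lambda_s}\Big)^{-3.5}\Big).$$ Each BS of tier $t$ carries an independent mark (numbers of its UL and DL users) with law $\Upsilon_t(\cdot,\cdot,3.5)$, and each MBS an independent number of SBSs having a DL UE with law $\kappa_{\epsilon_{s,d}}$. On $\mathcal E_t$, the numbers of UL and DL users of $X^*$ apart from the typical UE have law $\Upsilon_t(\cdot,\cdot,4.5)$, and the number $N_{s,d}$ of SBSs of $X^{**}$ having a DL UE (including $X^*$) has law $\kappa^*_{\epsilon_{s,d}}$, independently of the rest. $\kappa^*_{d,s}$ is $\kappa^*_\epsilon$ with $\epsilon=\eta\lambda_u\mathcal A_s/\lambda_s$. *Frames.* A frame has $\mathrm F\ge1$ slots of length $T$; "random rounding" of $x$ is $\lceil x\rceil$ with probability $x-\lfloor x\rfloor$ and $\lfloor x\rfloor$ otherwise. $\mathrm F_a$ rounds $\delta\mathrm F$ and $\mathrm F_{bd}$ rounds $\eta(\mathrm F-\mathrm F_a)$, for all BSs jointly. Under static TDD ($w_a=S$) $\mathrm F_{ad}$ rounds $\gamma_a\mathrm F_a$ for all BSs jointly, with a constant $\gamma_a$; under dynamic TDD ($w_a=D$)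 every BS with $n_u$ UL and $n_d$ DL users rounds $\mathrm F_an_d/(n_u+n_d)$ ($0$ if $n_d=0$) independently. $\mathcal F$ consists of $\mathrm F_a$, $\mathrm F_{bd}$ and, for $w_a=S$, $\mathrm F_{ad}$. In slots $i\le\mathrm F_{ad}$ of its own a BS with a DL user transmits, and in slots $\mathrm F_{ad}<i\le\mathrm F_a$ a uniformly chosen UL UE of a BS with an UL user transmits to it. In the DL backhaul slots $\mathrm F_a<i\le\mathrm F_a+\mathrm F_{bd}$ an MBS transmits to a uniformly chosen one of its SBSs that have a DL UE; under UAB ($w_b=\mathrm{UAB}$) an SBS with a DL UE not scheduled for backhaul transmits to one of its DL UEs with probability $p_{dl}$, under SAB it is silent. BSs serve their DL UEs uniformly at random in each slot, for access and for backhaul data. *SINR.* $\mathsf{SINR}^{dl}_{i,a}$ is the SINR at the origin of the signal from $X^*$, with interference from all other transmitters in slot $i$ if $i\le \mathrm F_a$, and, in DL backhaul slots, from all MBSs other than $X^{**}$ and all poaching SBSs other than $X^*$. $\mathsf{SINR}^{dl}_{i,b}$ is the SINR at $X^*\in\Phi_s$ of the signal from $X^{**}$, with interference from the MBSs other than $X^{**}$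 and, under UAB, the poaching SBSs. Each is taken for an active link, i.e. with $X^{**}$ not scheduling, respectively scheduling, $X^*$ in the backhaul slot. The SINR coverages are $\mathsf S^{dl,t}_{i,a}(\tau)=\mathbb P(\mathsf{SINR}^{dl}_{i,a}>\tau\mid\mathcal E_t,\mathcal F)$ and $\mathsf S^{dl}_{i,b}(\tau)=\mathbb P(\mathsf{SINR}^{dl}_{i,b}>\tau\mid\mathcal E_s,\mathcal F)$. *Rates.* Let $\mathrm D_m$ and $\mathrm D_{s,a}$ be the data ($WT\log_2(1+\mathsf{SINR}^{dl}_{i,a})$ per slot in which it is served) that the typical UE receives in a frame on the access link, in the access subframe and, for $\mathrm D_{s,a}$ under UAB, also in poached backhaul slots; let $\mathrm D_{s,b}$ be the data of the typical UE that $X^*$ receives in a frame over the backhaul. Put $\mathrm R_m=\mathbb E[\mathrm D_m\mid\mathcal E_m]/(T\mathrm F)$, $\mathrm R_s=\mathbb E_{\mathcal F}\min(\mathbb E[\mathrm D_{s,a}\mid\mathcal E_s,\mathcal F],\mathbb E[\mathrm D_{s,b}\mid\mathcal E_s,\mathcal F])/(T\mathrm F)$ and let $\mathrm R_{dl}=\mathcal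 A_m\mathrm R_m+\mathcal A_s\mathrm R_s$ be the (min-of-means) mean rate of the typical DL UE. *Claim.* $\mathcal A_m+\mathcal A_s=1$, and for all $w_a\in\{S,D\}$, $w_b\in\{\mathrm{SAB},\mathrm{UAB}\}$ we have $\mathrm R_{dl}=\mathcal A_m\mathrm R_{dl,m}+\mathcal A_s\mathrm R_{dl,s}$ with $\mathrm R_m=\mathrm R_{dl,m}$, $\mathrm R_s=\mathrm R_{dl,s}$ given by $$\mathrm R_{dl,m}=\mathbb E_{\mathcal F}\frac{W}{\mathrm F\ln2}\sum_{n_1,n_2\ge0}\frac{\Upsilon_m(n_1,n_2,4.5)}{n_2+1}\,\mathbb E_{\mathrm F_{ad}}\!\int_0^\infty\frac{\sum_{i=1}^{\mathrm F_{ad}}\mathsf S^{dl,m}_{i,a}(\tau)}{1+\tau}d\tau,\qquad \mathrm R_{dl,s}=\mathbb E_{\mathcal F}\frac{\min(\mathrm R_{a},\mathrm R_{b})}{T\mathrm F},$$ $$\mathrm R_a=\frac{WT}{\ln 2}\sum_{n_1,n_2\ge0}\frac{\Upsilon_s(n_1,n_2,4.5)}{n_2+1}\,\mathbb E_{\mathrm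 F_{ad}}\!\int_0^\infty\frac{\sum_{i=1}^{\mathrm F_{ad}}\mathsf S^{dl,s}_{i,a}(\tau)}{1+\tau}d\tau +\mathbf 1(w_b=\mathrm{UAB})\frac{WT}{\ln2}\Big(1-\mathbb E\tfrac1{N_{s,d}}\Big)p_{dl}\sum_{n\ge1}\frac{\kappa^*_{d,s}(n)}{n}\int_0^\infty\frac{\sum_{i=1+\mathrm F_a}^{\mathrm F_a+\mathrm F_{bd}}\mathsf S^{dl,s}_{i,a}(\tau)}{1+\tau}d\tau,$$ $$\mathrm R_b=\frac{WT}{\ln2}\,\mathbb E\Big[\tfrac1{N_{s,d}}\Big]\sum_{n\ge1}\frac{\kappa^*_{d,s}(n)}{n}\int_0^\infty\frac{\sum_{i=1+\mathrm F_a}^{\mathrm F_a+\mathrm F_{bd}}\mathsf S^{dl}_{i,b}(\tau)}{1+\tau}d\tau ,$$ where $\mathbb E_{\mathrm F_{ad}}$ averages over the random rounding of $X^*$'s DL access length given $\mathcal F$ and its loads ($n_1$ UL, $n_2+1$ DL), and empty sums are $0$. Moreover $\mathbb E[\mathrm D_{s,a}\mid\mathcal E_s,\mathcal F]=\mathrm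 R_a$ and $\mathbb E[\mathrm D_{s,b}\mid\mathcal E_s,\mathcal F]=\mathrm R_b$. Finally, let the ergodic rate be $\mathcal A_m\mathrm R_m+\mathcal A_s\,\mathbb E\big[\min(\mathbb E[\mathrm D_{s,a}\mid\mathcal G,\mathcal E_s],\mathbb E[\mathrm D_{s,b}\mid\mathcal G,\mathcal E_s])\mid\mathcal E_s\big]/(T\mathrm F)$. For $\mathcal G=\sigma(\Phi_m,\Phi_s,\Phi_u,\mathcal F)$ it is at most $\mathcal A_m\mathrm R_{dl,m}+\mathcal A_s\mathrm R_{dl,s}$, and for $\mathcal G=\sigma(\Phi_m,\Phi_s,\Phi_u)$ it is at most $\mathcal A_m\mathrm R_{dl,m}+\mathcal A_s\min(\mathbb E_{\mathcal F}\mathrm R_a,\mathbb E_{\mathcal F}\mathrm R_b)/(T\mathrm F)$. -/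

import Mathlib

open MeasureTheory ProbabilityTheory
open scoped ENNReal NNReal

namespace SelfBackhaul

noncomputable section

open scoped Classical

/-! ### Parameters -/

/-- Tier of a base station: master (`m`) or slave (`s`). -/
inductive Tier
  | m
  | s

/-- Kind of a device: master BS, slave BS, or user equipment. -/
inductive Kind
  | m
  | s
  | u

def Tier.kind : Tier → Kind
  | .m => .m
  | .s => .s

/-- Scheme in the access subframe: static or dynamic TDD. -/
inductive AccessScheme
  | static
  | dynamic

/-- Scheme in the backhaul subframe: synchronized or unsynchronized access-backhaul. -/
inductive BackhaulScheme
  | SAB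
  | UAB

/-- The numerical parameters of the network. -/
structure Params where
  /-- BS densities of the two tiers and UE density -/
  lam : Tier → ℝ
  lamU : ℝ
  /-- transmit powers, main lobe gains, side lobe gains, half power beam widths -/
  power : Kind → ℝ
  mainGain : Kind → ℝ
  sideGain : Kind → ℝ
  beam : Kind → ℝ
  /-- association biases -/
  bias : Tier → ℝ
  /-- LOS and NLOS path loss exponents; LOS ball model -/
  alphaL : ℝ
  alphaN : ℝ
  pLOS : ℝ
  dLOS : ℝ
  /-- reference path loss, noise power, bandwidth, slot duration -/
  C0 : ℝ
  noise : ℝ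
  bw : ℝ
  T : ℝ
  /-- frame size in slots, fraction of access slots, fraction of DL UEs,
  DL fraction of static TDD, DL poaching probability -/
  F : ℕ
  delta : ℝ
  eta : ℝ
  gammaA : ℝ
  pdl : ℝ
  lam_pos : ∀ t, 0 < lam t
  lamU_pos : 0 < lamU
  power_pos : ∀ k, 0 < power k
  mainGain_pos : ∀ k, 0 < mainGain k
  sideGain_nonneg : ∀ k, 0 ≤ sideGain k
  beam_mem : ∀ k, beam k ∈ Set.Icc 0 (2 * Real.pi)
  bias_pos : ∀ t, 0 < bias t
  alphaL_pos : 0 < alphaL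
  alphaN_pos : 0 < alphaN
  pLOS_mem : pLOS ∈ Set.Icc (0 : ℝ) 1
  dLOS_nonneg : 0 ≤ dLOS
  C0_pos : 0 < C0
  noise_pos : 0 < noise
  bw_pos : 0 < bw
  T_pos : 0 < T
  F_pos : 0 < F
  delta_mem : delta ∈ Set.Icc (0 : ℝ) 1
  eta_mem : eta ∈ Set.Icc (0 : ℝ) 1
  gammaA_mem : gammaA ∈ Set.Icc (0 : ℝ) 1
  pdl_mem : pdl ∈ Set.Icc (0 : ℝ) 1

/-- Density of the point process of devices of a given kind. -/
def Params.density (P : Params) : Kind → ℝ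
  | .m => P.lam .m
  | .s => P.lam .s
  | .u => P.lamU

/-- LOS probability of a link of length `d`. -/
def Params.losProb (P : Params) (d : ℝ) : ℝ := if d ≤ P.dLOS then P.pLOS else 0

/-! ### Load distributions -/

/-- PMF of the number of devices connected to a typical BS, `eps` being the mean. -/
def kappa (eps : ℝ) (n : ℕ) : ℝ :=
  (3.5 : ℝ) ^ (3.5 : ℝ) * Real.Gamma (n + 3.5) * eps ^ n * (3.5 + eps) ^ (-(n : ℝ) - 3.5) /
    (n.factorial * Real.Gamma 3.5)

/-- PMF of the number of devices connected to the tagged BS (supported on `n ≥ 1`). -/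
def kappaStar (eps : ℝ) (n : ℕ) : ℝ :=
  if n = 0 then 0 else
    (3.5 : ℝ) ^ (3.5 : ℝ) * Real.Gamma (n + 3.5) * eps ^ (n - 1) *
      (3.5 + eps) ^ (-(n : ℝ) - 3.5) / ((n - 1).factorial * Real.Gamma 3.5)

/-- Joint PMF `Υ(n₁, n₂, k)` of the numbers of UL users (`n₁`) and DL users (`n₂`),
`eps` being the mean number of users of a typical BS of the tier. -/
def upsilon (eta eps : ℝ) (n1 n2 : ℕ) (k : ℝ) : ℝ :=
  (3.5 : ℝ) ^ (3.5 : ℝ) / Real.Gamma 3.5 *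
    (eta ^ n2 * (1 - eta) ^ n1 / (n1.factorial * n2.factorial)) *
    (Real.Gamma (n1 + n2 + k) / (eps ^ k * (1 + 3.5 / eps) ^ ((n1 : ℝ) + n2 + k)))

/-! ### Random elements of the model -/

abbrev Plane := EuclideanSpace ℝ (Fin 2)

/-- Devices: the typical UE at the origin, the `k`-th BS of a tier, the `k`-th other UE. -/
inductive Node
  | origin
  | bs (t : Tier) (k : ℕ)
  | ue (k : ℕ)

def Node.kind : Node → Kind
  | .origin => .u
  | .bs t _ => t.kind
  | .ue _ => .u

/-- Labels of the uniform random variables that drive blockage, rounding and scheduling. -/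
inductive Coin
  /-- blockage state of the link between two devices -/
  | los (e : Sym2 Node)
  /-- UL or DL type of the `k`-th UE -/
  | ulMark (k : ℕ)
  /-- rounding of the DL access subframe of a (non-tagged) BS -/
  | round (t : Tier) (k : ℕ)
  /-- choice of the UL UE scheduled by a BS in slot `i` -/
  | uePick (t : Tier) (k i : ℕ)
  /-- choice of the SBS scheduled by the `k`-th MBS in backhaul slot `i` -/
  | sbsPick (k i : ℕ)
  /-- poaching decision of the `k`-th SBS in slot `i` -/
  | poach (k i : ℕ)
  /-- roundings of the common subframe lengths -/
  | frameA
  | frameBD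
  | frameAD
  /-- rounding of the DL access subframe of the tagged BS -/
  | tagRound
  /-- is the typical UE the one picked by the tagged BS for access in slot `i`? -/
  | tagUePick (i : ℕ)
  /-- poaching decision of the tagged SBS in slot `i` -/
  | tagPoach (i : ℕ)
  /-- is the tagged SBS the one picked by its MBS in backhaul slot `i`? -/
  | tagSbsPick (i : ℕ)
  /-- is the data sent to the tagged SBS in backhaul slot `i` that of the typical UE? -/
  | tagTxPick (i : ℕ)

/-- Labels of the independent sources of randomness. -/
inductive Source
  | points (k : Kind)
  | coin (c : Coin)
  | fading (X Y : Node)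
  | gain (X Y : Node)
  | load (t : Tier) (k : ℕ)
  | loadSD (k : ℕ)
  | tagLoad (t : Tier)
  | tagSD

/-- The random elements of the network, on a sample space `Ω`. -/
structure Network (Ω : Type*) where
  /-- enumerations of the points of the MBS, SBS and UE processes -/
  pos : Kind → ℕ → Ω → Plane
  coin : Coin → Ω → ℝ
  /-- `fading X Y i`: small scale fading at receiver `X` from transmitter `Y` in slot `i` -/
  fading : Node → Node → ℕ → Ω → ℝ
  /-- `gain X Y i`: antenna gain of the interfering link from `Y` to `X` in slot `i` -/
  gain : Node → Node → ℕ → Ω → ℝ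
  /-- numbers (UL, DL) of users of a BS -/
  load : Tier → ℕ → Ω → ℕ × ℕ
  /-- number of SBSs with at least one DL UE connected to an MBS -/
  loadSD : ℕ → Ω → ℕ
  /-- numbers (UL, DL) of users of the tagged BS apart from the typical UE, if it has tier `t` -/
  tagLoad : Tier → Ω → ℕ × ℕ
  /-- number of SBSs with at least one DL UE connected to the MBS that serves the tagged SBS,
  the tagged SBS included -/
  tagSD : Ω → ℕ

/-- The subframe lengths that are common to all BSs: access, DL backhaul and, for static TDD,
DL access. -/
structure FrameLengths where
  Fa : ℕ
  Fbd : ℕ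
  Fad : ℕ

instance : MeasurableSpace FrameLengths := ⊤

/-- Rounding of `x ≥ 0` to `⌈x⌉` with probability `x - ⌊x⌋` and to `⌊x⌋` otherwise, driven by
the uniform variable `v`. -/
def randRound (x v : ℝ) : ℕ := ⌊x⌋₊ + if v < Int.fract x then 1 else 0

/-- Fraction of DL users among `u` UL and `d` DL users (it is `0` for `d = 0`). -/
def dlFraction (u d : ℕ) : ℝ := (d : ℝ) / ((u : ℝ) + d)

/-- A uniformly chosen element of the finite set `{j | p j}`, driven by the uniform variable `v`;
`none` if there is no element to choose. -/
def uniformPick (p : ℕ → Prop) (v : ℝ) : Option ℕ :=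
  if {j | p j}.ncard = 0 then none else some (Nat.nth p ⌊v * ({j | p j}.ncard : ℝ)⌋₊)

namespace Network

variable {Ω : Type*} (P : Params) (N : Network Ω)

/-! ### Geometry and association -/

def location : Node → Ω → Plane
  | .origin, _ => 0
  | .bs t k, ω => N.pos t.kind k ω
  | .ue k, ω => N.pos .u k ω

def isLOS (X Y : Node) (ω : Ω) : Prop :=
  N.coin (.los s(X, Y)) ω < P.losProb (dist (N.location X ω) (N.location Y ω))

def pathLoss (X Y : Node) (ω : Ω) : ℝ :=
  dist (N.location X ω) (N.location Y ω) ^ (if N.isLOS P X Y ω then P.alphaL else P.alphaN)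

/-- Index of the BS of tier `t` with the smallest path loss to `Z`. -/
def best (t : Tier) (Z : Node) (ω : Ω) : ℕ :=
  sInf {k | ∀ j, N.pathLoss P (.bs t k) Z ω ≤ N.pathLoss P (.bs t j) Z ω}

/-- Largest biased received power at `Z` from tier `t`. -/
def biasedPower (t : Tier) (Z : Node) (ω : Ω) : ℝ :=
  P.power t.kind * P.mainGain t.kind * P.bias t / N.pathLoss P (.bs t (N.best P t Z ω)) Z ω

/-- Tier of the BS with which a UE at `Z` associates. -/
def assocTier (Z : Node) (ω : Ω) : Tier :=
  if N.biasedPower P .s Z ω < N.biasedPower P .m Z ω then .m else .s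

/-- The BS with which a UE at `Z` associates. -/
def serving (Z : Node) (ω : Ω) : Node :=
  .bs (N.assocTier P Z ω) (N.best P (N.assocTier P Z ω) Z ω)

def tagTier (ω : Ω) : Tier := N.assocTier P .origin ω

def tagIndex (ω : Ω) : ℕ := N.best P (N.tagTier P ω) .origin ω

/-- The BS `X*` that serves the typical UE. -/
def tagBS (ω : Ω) : Node := N.serving P .origin ω

/-- Index of the MBS `X**` that serves the tagged SBS. -/
def tagMBS (ω : Ω) : ℕ := N.best P .m (N.tagBS P ω) ω

/-! ### Frame structure -/

def frameA (ω : Ω) : ℕ := randRound (P.delta * P.F) (N.coin .frameA ω)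

def frameBD (ω : Ω) : ℕ :=
  randRound (((P.F : ℝ) - N.frameA P ω) * P.eta) (N.coin .frameBD ω)

def frameAD (ω : Ω) : ℕ := randRound (N.frameA P ω * P.gammaA) (N.coin .frameAD ω)

/-- The common subframe lengths `𝓕`; the DL access length belongs to them for static TDD only
(under dynamic TDD that entry is a dummy). -/
def frame (wa : AccessScheme) (ω : Ω) : FrameLengths where
  Fa := N.frameA P ω
  Fbd := N.frameBD P ω
  Fad := match wa with
    | .static => N.frameAD P ω
    | .dynamic => 0

/-- Number of DL access slots of a BS other than the tagged one. -/
def bsFad (wa : AccessScheme) (f : FrameLengths) (t : Tier) (k : ℕ) (ω : Ω) : ℕ :=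
  match wa with
  | .static => f.Fad
  | .dynamic =>
    randRound (f.Fa * dlFraction (N.load t k ω).1 (N.load t k ω).2) (N.coin (.round t k) ω)

/-! ### Interference -/

/-- Received power at `X` from an interferer `Y` in slot `i`. -/
def rxPower (i : ℕ) (X Y : Node) (ω : Ω) : ℝ≥0∞ :=
  ENNReal.ofReal
    (P.C0 * P.power Y.kind * N.fading X Y i ω * N.gain X Y i ω / N.pathLoss P X Y ω)

/-- The UL UE scheduled by a BS in slot `i`. -/
def scheduledUE (t : Tier) (k i : ℕ) (ω : Ω) : Option ℕ :=
  uniformPick (fun j => P.eta ≤ N.coin (.ulMark j) ω ∧ N.serving P (.ue j) ω = .bs t k)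
    (N.coin (.uePick t k i) ω)

/-- Interference at `Z` in access slot `i` from the BSs of tier `t` other than the tagged one. -/
def accessBSInterference (wa : AccessScheme) (f : FrameLengths) (t : Tier) (i : ℕ) (Z : Node)
    (ω : Ω) : ℝ≥0∞ :=
  ∑' k : ℕ, if Node.bs t k ≠ N.tagBS P ω ∧ i ≤ N.bsFad wa f t k ω ∧ 0 < (N.load t k ω).2
    then N.rxPower P i Z (.bs t k) ω else 0

/-- Interference at `Z` in access slot `i` from the UL UEs scheduled by the BSs of tier `t`
other than the tagged one. -/
def accessUEInterference (wa : AccessScheme) (f : FrameLengths) (t : Tier) (i : ℕ) (Z : Node)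
    (ω : Ω) : ℝ≥0∞ :=
  ∑' k : ℕ, if Node.bs t k ≠ N.tagBS P ω ∧ N.bsFad wa f t k ω < i ∧ i ≤ f.Fa ∧
      0 < (N.load t k ω).1
    then (N.scheduledUE P t k i ω).elim 0 (fun j => N.rxPower P i Z (.ue j) ω) else 0

/-- Interference at `Z` in DL backhaul slot `i` from the MBSs other than `X**`. -/
def backhaulMBSInterference (f : FrameLengths) (i : ℕ) (Z : Node) (ω : Ω) : ℝ≥0∞ :=
  ∑' k : ℕ, if k ≠ N.tagMBS P ω ∧ f.Fa < i ∧ i ≤ f.Fa + f.Fbd ∧ 0 < N.loadSD k ω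
    then N.rxPower P i Z (.bs .m k) ω else 0

/-- The SBS scheduled by the `M`-th MBS in DL backhaul slot `i`: uniform among its SBSs with at
least one DL UE. `tagActive` says whether `X**` schedules the tagged SBS in that slot; if it does
not, it schedules one of its other SBSs. -/
def scheduledSBS (tagActive : Prop) (M i : ℕ) (ω : Ω) : Option ℕ :=
  if M = N.tagMBS P ω ∧ tagActive then some (N.tagIndex P ω) else
    uniformPick (fun j => N.best P .m (.bs .s j) ω = M ∧ 0 < (N.load .s j ω).2 ∧
      Node.bs .s j ≠ N.tagBS P ω) (N.coin (.sbsPick M i) ω)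

/-- Interference at `Z` in DL backhaul slot `i` from the poaching SBSs other than the tagged one:
those with a DL UE that are not scheduled by their MBS and decide to poach. -/
def poachingInterference (tagActive : Prop) (f : FrameLengths) (i : ℕ) (Z : Node)
    (ω : Ω) : ℝ≥0∞ :=
  ∑' k : ℕ, if Node.bs .s k ≠ N.tagBS P ω ∧ f.Fa < i ∧ i ≤ f.Fa + f.Fbd ∧
      0 < (N.load .s k ω).2 ∧
      N.scheduledSBS P tagActive (N.best P .m (.bs .s k) ω) i ω ≠ some k ∧
      N.coin (.poach k i) ω < P.pdl
    then N.rxPower P i Z (.bs .s k) ω else 0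

/-! ### SINR -/

/-- SINR of the DL access link `X* → 0` in slot `i`. In the backhaul subframe (`i > Fa`) this
link is active only under UAB and when `X**` does not schedule the tagged SBS. -/
def sinrAccess (wa : AccessScheme) (f : FrameLengths) (i : ℕ) (ω : Ω) : ℝ≥0∞ :=
  ENNReal.ofReal (P.C0 * P.power (N.tagTier P ω).kind * N.fading .origin (N.tagBS P ω) i ω *
      (P.mainGain .u * P.mainGain (N.tagTier P ω).kind) / N.pathLoss P .origin (N.tagBS P ω) ω) /
    ((if i ≤ f.Fa then
        N.accessBSInterference P wa f .m i .origin ω + N.accessBSInterference P wa f .s i .origin ω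
          + (N.accessUEInterference P wa f .m i .origin ω
            + N.accessUEInterference P wa f .s i .origin ω)
      else
        N.backhaulMBSInterference P f i .origin ω + N.poachingInterference P False f i .origin ω)
      + ENNReal.ofReal P.noise)

/-- SINR of the DL backhaul link `X** → X*` in slot `i`, which is active when `X**` schedules
the tagged SBS. -/
def sinrBackhaul (wb : BackhaulScheme) (f : FrameLengths) (i : ℕ) (ω : Ω) : ℝ≥0∞ :=
  ENNReal.ofReal (P.C0 * P.power .m *
      N.fading (N.tagBS P ω) (.bs .m (N.tagMBS P ω)) i ω *
      (P.mainGain .m * P.mainGain .s) /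
        N.pathLoss P (N.tagBS P ω) (.bs .m (N.tagMBS P ω)) ω) /
    (N.backhaulMBSInterference P f i (N.tagBS P ω) ω
      + (match wb with
        | .SAB => 0
        | .UAB => N.poachingInterference P True f i (N.tagBS P ω) ω)
      + ENNReal.ofReal P.noise)

/-! ### Scheduling of the typical UE and transmitted data -/

/-- UL users of the tagged BS. -/
def tagUL (ω : Ω) : ℕ := (N.tagLoad (N.tagTier P ω) ω).1

/-- DL users of the tagged BS, the typical one included. -/
def tagDL (ω : Ω) : ℕ := (N.tagLoad (N.tagTier P ω) ω).2 + 1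

/-- Number of DL access slots of the tagged BS. -/
def tagFad (wa : AccessScheme) (ω : Ω) : ℕ :=
  match wa with
  | .static => (N.frame P wa ω).Fad
  | .dynamic =>
    randRound ((N.frame P wa ω).Fa * dlFraction (N.tagUL P ω) (N.tagDL P ω)) (N.coin .tagRound ω)

/-- The tagged BS, when it serves a DL UE in slot `i`, serves the typical UE. -/
def uePicked (i : ℕ) (ω : Ω) : Prop := N.coin (.tagUePick i) ω < 1 / (N.tagDL P ω : ℝ)

/-- The tagged SBS is scheduled by its MBS in DL backhaul slot `i`. -/
def sbsScheduled (i : ℕ) (ω : Ω) : Prop := N.coin (.tagSbsPick i) ω < 1 / (N.tagSD ω : ℝ)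

/-- The tagged SBS poaches DL backhaul slot `i`. -/
def poaches (i : ℕ) (ω : Ω) : Prop :=
  ¬ N.sbsScheduled i ω ∧ N.coin (.tagPoach i) ω < P.pdl

/-- The tagged SBS is scheduled in DL backhaul slot `i` and receives the typical UE's data. -/
def backhaulServed (i : ℕ) (ω : Ω) : Prop :=
  N.sbsScheduled i ω ∧ N.coin (.tagTxPick i) ω < 1 / (N.tagDL P ω : ℝ)

/-- Spectral efficiency `log₂ (1 + x)`. -/
def spectralEff (x : ℝ≥0∞) : ℝ≥0∞ := ENNReal.ofReal (Real.logb 2 (1 + x.toReal))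

/-- Data received by the typical UE in the access subframe of a frame. -/
def dataAccess (wa : AccessScheme) (ω : Ω) : ℝ≥0∞ :=
  ENNReal.ofReal (P.bw * P.T) * ∑ i ∈ Finset.Icc 1 (N.tagFad P wa ω),
    if N.uePicked P i ω then spectralEff (N.sinrAccess P wa (N.frame P wa ω) i ω) else 0

/-- Data received by the typical UE from the tagged SBS in poached backhaul slots of a frame. -/
def dataPoached (wa : AccessScheme) (ω : Ω) : ℝ≥0∞ :=
  ENNReal.ofReal (P.bw * P.T) *
    ∑ i ∈ Finset.Icc ((N.frame P wa ω).Fa + 1) ((N.frame P wa ω).Fa + (N.frame P wa ω).Fbd),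
      if N.poaches P i ω ∧ N.uePicked P i ω
        then spectralEff (N.sinrAccess P wa (N.frame P wa ω) i ω) else 0

/-- `D_{dl,m}`: data received in a frame by the typical UE when it is served by an MBS. -/
def dataM (wa : AccessScheme) (ω : Ω) : ℝ≥0∞ := N.dataAccess P wa ω

/-- `D_{dl,s,a}`: data received in a frame by the typical UE when it is served by an SBS. -/
def dataSA (wa : AccessScheme) (wb : BackhaulScheme) (ω : Ω) : ℝ≥0∞ :=
  N.dataAccess P wa ω + match wb with
    | .SAB => 0
    | .UAB => N.dataPoached P wa ω

/-- `D_{dl,s,b}`: data of the typical UE received in a frame by the tagged SBS over the backhaul. -/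
def dataSB (wa : AccessScheme) (wb : BackhaulScheme) (ω : Ω) : ℝ≥0∞ :=
  ENNReal.ofReal (P.bw * P.T) *
    ∑ i ∈ Finset.Icc ((N.frame P wa ω).Fa + 1) ((N.frame P wa ω).Fa + (N.frame P wa ω).Fbd),
      if N.backhaulServed P i ω
        then spectralEff (N.sinrBackhaul P wb (N.frame P wa ω) i ω) else 0

/-! ### Laws -/

/-- The σ-algebra generated by a source of randomness. -/
@[reducible]
def sourceSigma : Source → MeasurableSpace Ω
  | .points k => MeasurableSpace.comap (fun ω (j : ℕ) => N.pos k j ω) inferInstance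
  | .coin c => MeasurableSpace.comap (N.coin c) inferInstance
  | .fading X Y => MeasurableSpace.comap (fun ω (i : ℕ) => N.fading X Y i ω) inferInstance
  | .gain X Y => MeasurableSpace.comap (fun ω (i : ℕ) => N.gain X Y i ω) inferInstance
  | .load t k => MeasurableSpace.comap (N.load t k) inferInstance
  | .loadSD k => MeasurableSpace.comap (N.loadSD k) inferInstance
  | .tagLoad t => MeasurableSpace.comap (N.tagLoad t) inferInstance
  | .tagSD => MeasurableSpace.comap N.tagSD inferInstance

/-- The σ-algebra generated by the BS and UE point processes. -/
@[reducible]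
def spatialSigma : MeasurableSpace Ω := ⨆ k, N.sourceSigma (.points k)

/-- The σ-algebra generated by the common subframe lengths. -/
@[reducible]
def frameSigma (wa : AccessScheme) : MeasurableSpace Ω :=
  MeasurableSpace.comap (N.frame P wa) inferInstance

variable [MeasurableSpace Ω] (μ : Measure Ω)

/-- The event that the typical UE is served by tier `t`. -/
def assocEvent (t : Tier) : Set Ω := {ω | N.tagTier P ω = t}

/-- Association probabilities `𝒜_m`, `𝒜_s`. -/
def assocProb (t : Tier) : ℝ := (μ (N.assocEvent P t)).toReal

/-- Mean number of users of a typical BS of tier `t`. -/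
def meanUsers (t : Tier) : ℝ := P.lamU * N.assocProb P μ t / P.lam t

/-- Mean number of DL users of a typical BS of tier `t`. -/
def meanDL (t : Tier) : ℝ := P.eta * P.lamU * N.assocProb P μ t / P.lam t

/-- Mean number of SBSs with at least one DL UE connected to a typical MBS. -/
def meanSD : ℝ :=
  P.lam .s * (1 - (1 + N.assocProb P μ .s * P.lamU * P.eta / (3.5 * P.lam .s)) ^ (-3.5 : ℝ)) /
    P.lam .m

/-- Number of points of a process in a region. -/
def pointCount (k : Kind) (B : Set Plane) (ω : Ω) : ℝ≥0∞ :=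
  ∑' j : ℕ, B.indicator (fun _ => (1 : ℝ≥0∞)) (N.pos k j ω)

/-- The points of kind `k` form a homogeneous Poisson point process with density `lam`. -/
structure IsPoisson (k : Kind) (lam : ℝ) : Prop where
  law : ∀ B : Set Plane, MeasurableSet B → volume B ≠ ∞ →
    μ.map (N.pointCount k B) =
      (poissonMeasure (lam * (volume B).toReal).toNNReal).map (fun n : ℕ => (n : ℝ≥0∞))
  indep : ∀ B : ℕ → Set Plane, (∀ n, MeasurableSet (B n)) → Pairwise (fun a b => Disjoint (B a) (B b)) →
    iIndepFun (fun n => N.pointCount k (B n)) μ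

/-- Law of the antenna gain of an interfering link between devices of kinds `a` and `b`. -/
def gainLaw (a b : Kind) : Measure ℝ :=
  ENNReal.ofReal (P.beam a * P.beam b / (4 * Real.pi ^ 2)) •
      Measure.dirac (P.mainGain a * P.mainGain b)
    + ENNReal.ofReal (P.beam a * (2 * Real.pi - P.beam b) / (4 * Real.pi ^ 2)) •
      Measure.dirac (P.mainGain a * P.sideGain b)
    + ENNReal.ofReal ((2 * Real.pi - P.beam a) * P.beam b / (4 * Real.pi ^ 2)) •
      Measure.dirac (P.sideGain a * P.mainGain b)
    + ENNReal.ofReal ((2 * Real.pi - P.beam a) * (2 * Real.pi - P.beam b) / (4 * Real.pi ^ 2)) •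
      Measure.dirac (P.sideGain a * P.sideGain b)

/-- The distributional description of the network: Poisson points, uniform coins, unit mean
exponential fading and antenna gains with arbitrary correlation across slots, and loads given by
the independent load model, all sources being independent. -/
structure IsModel : Prop where
  measurable : ∀ a, N.sourceSigma a ≤ ‹MeasurableSpace Ω›
  indep : iIndep N.sourceSigma μ
  poisson : ∀ k, N.IsPoisson μ k (P.density k)
  coin_law : ∀ c, μ.map (N.coin c) = volume.restrict (Set.Icc (0 : ℝ) 1)
  fading_law : ∀ X Y i, μ.map (N.fading X Y i) = expMeasure 1
  gain_law : ∀ X Y i, μ.map (N.gain X Y i) = gainLaw P X.kind Y.kind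
  load_law : ∀ t k n1 n2, μ {ω | N.load t k ω = (n1, n2)} =
    ENNReal.ofReal (upsilon P.eta (N.meanUsers P μ t) n1 n2 3.5)
  loadSD_law : ∀ k n, μ {ω | N.loadSD k ω = n} = ENNReal.ofReal (kappa (N.meanSD P μ) n)
  tagLoad_law : ∀ t n1 n2, μ {ω | N.tagLoad t ω = (n1, n2)} =
    ENNReal.ofReal (upsilon P.eta (N.meanUsers P μ t) n1 n2 4.5)
  tagSD_law : ∀ n, μ {ω | N.tagSD ω = n} = ENNReal.ofReal (kappaStar (N.meanSD P μ) n)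

/-! ### Mean rates -/

/-- The probability measure given that the typical UE is served by tier `t`. -/
def condTier (t : Tier) : Measure Ω := cond μ (N.assocEvent P t)

/-- The probability measure given the serving tier and the common subframe lengths. -/
def condTierFrame (wa : AccessScheme) (t : Tier) (f : FrameLengths) : Measure Ω :=
  cond μ (N.assocEvent P t ∩ {ω | N.frame P wa ω = f})

/-- Expectation over the common subframe lengths. -/
def frameExp (wa : AccessScheme) (g : FrameLengths → ℝ≥0∞) : ℝ≥0∞ :=
  ∫⁻ ω, g (N.frame P wa ω) ∂μ

/-- Mean rate of the typical UE given that it is served by an MBS. -/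
def rateM (wa : AccessScheme) : ℝ≥0∞ :=
  (∫⁻ ω, N.dataM P wa ω ∂(N.condTier P μ .m)) / ENNReal.ofReal (P.T * P.F)

/-- Mean data per frame over the access link of a UE served by an SBS, given `𝓕 = f`. -/
def meanDataSA (wa : AccessScheme) (wb : BackhaulScheme) (f : FrameLengths) : ℝ≥0∞ :=
  ∫⁻ ω, N.dataSA P wa wb ω ∂(N.condTierFrame P μ wa .s f)

/-- Mean data per frame over the backhaul link of a UE served by an SBS, given `𝓕 = f`. -/
def meanDataSB (wa : AccessScheme) (wb : BackhaulScheme) (f : FrameLengths) : ℝ≥0∞ :=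
  ∫⁻ ω, N.dataSB P wa wb ω ∂(N.condTierFrame P μ wa .s f)

/-- Min-of-means rate of the typical UE given that it is served by an SBS: the smaller of the
conditional mean access and backhaul data given `𝓕`, averaged over `𝓕`, per unit of time. -/
def rateS (wa : AccessScheme) (wb : BackhaulScheme) : ℝ≥0∞ :=
  N.frameExp P μ wa (fun f =>
    min (N.meanDataSA P μ wa wb f) (N.meanDataSB P μ wa wb f) / ENNReal.ofReal (P.T * P.F))

/-- Mean rate of the typical DL UE, with the min-of-means rate when it is served by an SBS. -/
def rateDL (wa : AccessScheme) (wb : BackhaulScheme) : ℝ≥0∞ :=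
  ENNReal.ofReal (N.assocProb P μ .m) * N.rateM P μ wa
    + ENNReal.ofReal (N.assocProb P μ .s) * N.rateS P μ wa wb

/-! ### SINR coverage and the rate formulas -/

/-- Coverage of the DL access link in slot `i`, given the serving tier and `𝓕 = f`. -/
def covAccess (wa : AccessScheme) (t : Tier) (f : FrameLengths) (i : ℕ) (τ : ℝ) : ℝ≥0∞ :=
  N.condTierFrame P μ wa t f {ω | ENNReal.ofReal τ < N.sinrAccess P wa (N.frame P wa ω) i ω}

/-- Coverage of the DL backhaul link of the tagged SBS in slot `i`, given `𝓕 = f`. -/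
def covBackhaul (wa : AccessScheme) (wb : BackhaulScheme) (f : FrameLengths) (i : ℕ) (τ : ℝ) :
    ℝ≥0∞ :=
  N.condTierFrame P μ wa .s f {ω | ENNReal.ofReal τ < N.sinrBackhaul P wb (N.frame P wa ω) i ω}

end Network

/-- `∫₀^∞ (∑_{i=a}^{b} S_i(τ)) / (1 + τ) dτ`; the sum is zero if `b < a`. -/
def coverageIntegral (S : ℕ → ℝ → ℝ≥0∞) (a b : ℕ) : ℝ≥0∞ :=
  ∫⁻ τ in Set.Ioi (0 : ℝ), (∑ i ∈ Finset.Icc a b, S i τ) / ENNReal.ofReal (1 + τ)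

/-- Average of `g` over the number of DL access slots of the tagged BS, given `𝓕 = f` and `n1` UL
and `n2 + 1` DL users. -/
def tagFadMean (wa : AccessScheme) (f : FrameLengths) (n1 n2 : ℕ) (g : ℕ → ℝ≥0∞) : ℝ≥0∞ :=
  match wa with
  | .static => g f.Fad
  | .dynamic =>
    let x := (f.Fa : ℝ) * dlFraction n1 (n2 + 1)
    ENNReal.ofReal (x - ⌊x⌋₊) * g ⌈x⌉₊ + ENNReal.ofReal (1 - (x - ⌊x⌋₊)) * g ⌊x⌋₊

namespace Network

variable {Ω : Type*} (P : Params) (N : Network Ω) [MeasurableSpace Ω] (μ : Measure Ω)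

/-- `∑_{n₁,n₂} Υ_t(n₁,n₂,4.5)/(n₂+1) ∫ ∑_{i=1}^{F_ad} S_i(τ)/(1+τ) dτ`. -/
def accessSum (wa : AccessScheme) (t : Tier) (f : FrameLengths) : ℝ≥0∞ :=
  ∑' (n1 : ℕ) (n2 : ℕ),
    ENNReal.ofReal (upsilon P.eta (N.meanUsers P μ t) n1 n2 4.5 / ((n2 : ℝ) + 1)) *
      tagFadMean wa f n1 n2 (fun b => coverageIntegral (N.covAccess P μ wa t f) 1 b)

/-- `E[1/N_{s,d}]`. -/
def invSD : ℝ := ∑' n : ℕ, kappaStar (N.meanSD P μ) n / n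

/-- `∑_{n ≥ 1} κ*_{d,s}(n) / n`. -/
def invDL : ℝ := ∑' n : ℕ, kappaStar (N.meanDL P μ .s) n / n

/-- The formula for the rate of a UE served by an MBS. -/
def formulaM (wa : AccessScheme) : ℝ≥0∞ :=
  N.frameExp P μ wa (fun f =>
    ENNReal.ofReal (P.bw / (P.F * Real.log 2)) * N.accessSum P μ wa .m f)

/-- The formula for the mean access data per frame of a UE served by an SBS. -/
def formulaSA (wa : AccessScheme) (wb : BackhaulScheme) (f : FrameLengths) : ℝ≥0∞ :=
  ENNReal.ofReal (P.bw * P.T / Real.log 2) * N.accessSum P μ wa .s f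
    + match wb with
      | .SAB => 0
      | .UAB =>
        ENNReal.ofReal (P.bw * P.T / Real.log 2 * (1 - N.invSD P μ) * P.pdl * N.invDL P μ) *
          coverageIntegral (N.covAccess P μ wa .s f) (1 + f.Fa) (f.Fa + f.Fbd)

/-- The formula for the mean backhaul data per frame of a UE served by an SBS. -/
def formulaSB (wa : AccessScheme) (wb : BackhaulScheme) (f : FrameLengths) : ℝ≥0∞ :=
  ENNReal.ofReal (P.bw * P.T / Real.log 2 * N.invSD P μ * N.invDL P μ) *
    coverageIntegral (N.covBackhaul P μ wa wb f) (1 + f.Fa) (f.Fa + f.Fbd)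

/-- The formula for the rate of a UE served by an SBS. -/
def formulaS (wa : AccessScheme) (wb : BackhaulScheme) : ℝ≥0∞ :=
  N.frameExp P μ wa (fun f =>
    min (N.formulaSA P μ wa wb f) (N.formulaSB P μ wa wb f) / ENNReal.ofReal (P.T * P.F))

/-- The rate formula of a UE served by an SBS with the minimum taken after averaging over `𝓕`. -/
def formulaSAveraged (wa : AccessScheme) (wb : BackhaulScheme) : ℝ≥0∞ :=
  min (N.frameExp P μ wa (N.formulaSA P μ wa wb)) (N.frameExp P μ wa (N.formulaSB P μ wa wb)) /
    ENNReal.ofReal (P.T * P.F)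

end Network

namespace Network

/-- Ergodic mean rate of the typical DL UE: when it is served by an SBS, its rate is the smaller
of its access and backhaul rates after averaging over all randomness outside `𝓢`. -/
def ergodicRate {Ω : Type*} (P : Params) (N : Network Ω) (𝓢 : MeasurableSpace Ω)
    [MeasurableSpace Ω] (μ : Measure Ω) (wa : AccessScheme) (wb : BackhaulScheme) : ℝ≥0∞ :=
  ENNReal.ofReal (N.assocProb P μ .m) * N.rateM P μ wa
    + ENNReal.ofReal (N.assocProb P μ .s) *
      ∫⁻ ω, min (condLExp 𝓢 (N.condTier P μ .s) (N.dataSA P wa wb) ω)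
        (condLExp 𝓢 (N.condTier P μ .s) (N.dataSB P wa wb) ω) / ENNReal.ofReal (P.T * P.F)
        ∂(N.condTier P μ .s)

end Network

end

end SelfBackhaul

/-! The sources of randomness split into three independent groups: the environment (positions,
channels, and loads and decisions of the interferers), the coins of the common subframe lengths, and
the loads and scheduling coins of the tagged base stations. Each SINR is defined for an active link,
with the scheduling of that link imposed rather than read off the coins, so it is a function of the
first two groups only. So is the conditioning event "serving tier `t`, frame `f`". On that event,
whether the typical UE is served in a given slot is decided by the third group alone. Hence the mean
data of a slot is the mean spectral efficiency times the probability of being served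
(`lintegral_condTierFrame_mul`).

The first factor is a layer cake integral: `log (1 + x)` is the integral of `1 / (1 + t)` over `[0,
x]`, so its mean is the integral of the coverage against `1 / (1 + τ)` (`lintegral_spectralEff`).
The second factor is, in backhaul slots, a product of means of `1 / n` over the loads
(`measure_sbsScheduled`, `measure_pickEvent`). That the DL load has law `kappaStar` with the thinned
mean follows by summing `upsilon` over the UL users, a negative binomial series (`tsum_upsilon`). In
access slots the length of the DL subframe and the pick of the UE depend on the same load, so both
stay under the sum over that load (`lintegral_dataAccess`).

The frame is independent of the serving tier, so averaging over it recovers the mean given the tier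
(`lintegral_condTier`). The ergodic bounds hold because the integral of a minimum is at most the
minimum of the integrals (`setLIntegral_min_condLExp_le`), used on each event `frame = f` when the
frame is part of the conditioning and on the whole space otherwise. All integrals live in `[0, ∞]`,
so sums and integrals are exchanged without integrability conditions. -/

namespace SelfBackhaul

open scoped Classical

/-! ### Measurability of random choices from countable sets -/

section Choice

variable {Ω : Type*} [MeasurableSpace Ω]

/-- A preimage splits along the countably many values of the index. Only the level sets of `n` have
to be measurable, so index types such as `Tier` and `Node` need no σ-algebra. -/
lemma measurable_countable_choice {α β : Type*} [Countable α] [MeasurableSpace β] {n : Ω → α}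
    (hn : ∀ a, MeasurableSet {ω | n ω = a}) {h : α → Ω → β} (hh : ∀ a, Measurable (h a)) :
    Measurable (fun ω => h (n ω) ω) := by
  intro s hs
  have : (fun ω => h (n ω) ω) ⁻¹' s = ⋃ a, {ω | n ω = a} ∩ h a ⁻¹' s := by
    ext ω
    simp
  rw [this]
  exact MeasurableSet.iUnion fun a => (hn a).inter (hh a hs)

lemma measurableSet_countable_choice {α : Type*} [Countable α] {n : Ω → α}
    (hn : ∀ a, MeasurableSet {ω | n ω = a}) {p : α → Ω → Prop}
    (hp : ∀ a, MeasurableSet {ω | p a ω}) : MeasurableSet {ω | p (n ω) ω} := by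
  have : {ω | p (n ω) ω} = ⋃ a, {ω | n ω = a} ∩ {ω | p a ω} := by
    ext ω
    simp
  rw [this]
  exact MeasurableSet.iUnion fun a => (hn a).inter (hp a)

/-- This expresses an infimum through countably many membership conditions. The second alternative
is the default `sInf ∅ = 0`, which cannot be dropped: a minimizer of the path loss need not exist at
every sample point. -/
lemma nat_sInf_eq_iff (S : Set ℕ) (m : ℕ) :
    sInf S = m ↔ (m ∈ S ∧ ∀ k < m, k ∉ S) ∨ (m = 0 ∧ ∀ k, k ∉ S) := by
  constructor
  · rintro rfl
    by_cases hS : S.Nonempty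
    · exact Or.inl ⟨Nat.sInf_mem hS, fun k hk => Nat.notMem_of_lt_sInf hk⟩
    · rw [Set.not_nonempty_iff_eq_empty] at hS
      subst hS
      simp
  · rintro (⟨h1, h2⟩ | ⟨rfl, h⟩)
    · refine le_antisymm (Nat.sInf_le h1) ?_
      by_contra! hlt
      exact h2 _ hlt (Nat.sInf_mem ⟨m, h1⟩)
    · exact Nat.sInf_eq_zero.2 (Or.inr (Set.eq_empty_of_forall_notMem h))

lemma measurableSet_sInf_eq {q : ℕ → Ω → Prop} (hq : ∀ k, MeasurableSet {ω | q k ω}) (m : ℕ) :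
    MeasurableSet {ω | sInf {k | q k ω} = m} := by
  have hq' : ∀ k, Measurable (q k) := fun k => measurableSet_setOfPred.1 (hq k)
  simp only [nat_sInf_eq_iff, Set.mem_ofPred_eq]
  refine measurableSet_setOfPred.2 ?_
  fun_prop

/-- Strong induction on `n`: the `n`-th index satisfying the predicate is the least one beyond all
earlier ones. The recursion through `sInf` also covers the default values of `Nat.nth`. -/
lemma measurableSet_nth_eq {q : ℕ → Ω → Prop} (hq : ∀ k, MeasurableSet {ω | q k ω}) (n m : ℕ) :
    MeasurableSet {ω | Nat.nth (fun k => q k ω) n = m} := by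
  induction n using Nat.strong_induction_on generalizing m with
  | _ n ih =>
    have h : ∀ ω, Nat.nth (fun k => q k ω) n =
        sInf {x | q x ω ∧ ∀ k < n, Nat.nth (fun k => q k ω) k < x} :=
      fun ω => Nat.nth_eq_sInf _ _
    simp only [h]
    have hlt : ∀ x, MeasurableSet {ω | ∀ k < n, Nat.nth (fun k => q k ω) k < x} := fun x => by
      have : {ω | ∀ k < n, Nat.nth (fun k => q k ω) k < x} =
          ⋂ k, ⋂ (_ : k < n), ⋃ y, ⋃ (_ : y < x), {ω | Nat.nth (fun k => q k ω) k = y} := by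
        ext ω
        simp
      rw [this]
      exact MeasurableSet.iInter fun k => MeasurableSet.iInter fun hk =>
        MeasurableSet.iUnion fun y => MeasurableSet.iUnion fun _ => ih k hk y
    exact measurableSet_sInf_eq
      (q := fun x ω => q x ω ∧ ∀ k < n, Nat.nth (fun k => q k ω) k < x)
      (fun x => (hq x).inter (hlt x)) m

lemma measurableSet_uniformPick_eq {p : ℕ → Ω → Prop} (hp : ∀ k, MeasurableSet {ω | p k ω})
    {v : Ω → ℝ} (hv : Measurable v) (o : Option ℕ) :
    MeasurableSet {ω | uniformPick (fun k => p k ω) (v ω) = o} := by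
  have hset : Measurable (fun ω => {k | p k ω}) := by
    refine measurable_set_iff.2 fun k => ?_
    exact measurableSet_setOfPred.1 (hp k)
  have hcard : Measurable (fun ω => {k | p k ω}.ncard) := measurable_ncard.comp hset
  have hidx : Measurable (fun ω => ⌊v ω * ({k | p k ω}.ncard : ℝ)⌋₊) := by
    refine Nat.measurable_floor.comp (hv.mul ?_)
    exact (measurable_from_top (f := fun n : ℕ => (n : ℝ))).comp hcard
  have h0 : MeasurableSet {ω | {k | p k ω}.ncard = 0} := hcard (measurableSet_singleton 0)
  have hnth : ∀ j, MeasurableSet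
      {ω | Nat.nth (fun k => p k ω) ⌊v ω * ({k | p k ω}.ncard : ℝ)⌋₊ = j} := fun j =>
    measurableSet_countable_choice (p := fun a ω => Nat.nth (fun k => p k ω) a = j)
      (fun a => hidx (measurableSet_singleton a)) (fun a => measurableSet_nth_eq hp a j)
  cases o with
  | none =>
    have : {ω | uniformPick (fun k => p k ω) (v ω) = none} = {ω | {k | p k ω}.ncard = 0} := by
      ext ω
      simp [uniformPick]
    rw [this]
    exact h0
  | some j =>
    have : {ω | uniformPick (fun k => p k ω) (v ω) = some j} = {ω | {k | p k ω}.ncard = 0}ᶜ ∩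
        {ω | Nat.nth (fun k => p k ω) ⌊v ω * ({k | p k ω}.ncard : ℝ)⌋₊ = j} := by
      ext ω
      simp [uniformPick]
    rw [this]
    exact h0.compl.inter (hnth j)

lemma measurable_randRound {x v : Ω → ℝ} (hx : Measurable x) (hv : Measurable v) :
    Measurable (fun ω => randRound (x ω) (v ω)) := by
  unfold randRound
  refine (Nat.measurable_floor.comp hx).add (Measurable.ite ?_ measurable_const measurable_const)
  exact measurableSet_lt hv (measurable_fract.comp hx)

end Choice

instance : Countable Tier :=
  Function.Injective.countable (f := fun t : Tier => match t with | .m => true | .s => false)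
    (by intro a b h; cases a <;> cases b <;> simp_all)

instance : Countable Node := by
  refine Function.Injective.countable
    (f := fun x : Node => match x with
      | .origin => (Sum.inl () : Unit ⊕ (Tier × ℕ) ⊕ ℕ)
      | .bs t k => Sum.inr (Sum.inl (t, k))
      | .ue k => Sum.inr (Sum.inr k)) ?_
  intro a b h
  cases a <;> cases b <;> simp_all

instance : Countable FrameLengths :=
  Function.Injective.countable (f := fun f : FrameLengths => (f.Fa, f.Fbd, f.Fad))
    (by rintro ⟨⟩ ⟨⟩ h; simpa using h)

/-! ### Measurability of association, interference and SINR -/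

namespace Network

variable {Ω : Type*} [MeasurableSpace Ω]

/-- Measurability of the random elements that describe the network seen by the tagged links. -/
structure EnvMeasurable (N : Network Ω) : Prop where
  pos : ∀ k j, Measurable (N.pos k j)
  los : ∀ e, Measurable (N.coin (.los e))
  ulMark : ∀ k, Measurable (N.coin (.ulMark k))
  round : ∀ t k, Measurable (N.coin (.round t k))
  uePick : ∀ t k i, Measurable (N.coin (.uePick t k i))
  sbsPick : ∀ k i, Measurable (N.coin (.sbsPick k i))
  poach : ∀ k i, Measurable (N.coin (.poach k i))
  fading : ∀ X Y i, Measurable (N.fading X Y i)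
  gain : ∀ X Y i, Measurable (N.gain X Y i)
  load : ∀ t k, Measurable (N.load t k)
  loadSD : ∀ k, Measurable (N.loadSD k)

namespace EnvMeasurable

variable {N : Network Ω} (h : N.EnvMeasurable) (P : Params)

include h

lemma measurable_location (X : Node) : Measurable (N.location X) := by
  cases X with
  | origin => exact measurable_const
  | bs t k => exact h.pos _ _
  | ue k => exact h.pos _ _

lemma measurable_pathLoss (X Y : Node) : Measurable (N.pathLoss P X Y) := by
  have hd : Measurable (fun ω => dist (N.location X ω) (N.location Y ω)) :=
    (h.measurable_location X).dist (h.measurable_location Y)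
  have hlos : MeasurableSet {ω | N.isLOS P X Y ω} := by
    refine measurableSet_lt (h.los _) ?_
    unfold Params.losProb
    exact Measurable.ite (measurableSet_le hd measurable_const) measurable_const measurable_const
  exact hd.pow (Measurable.ite hlos measurable_const measurable_const)

lemma measurableSet_best_eq (t : Tier) (Z : Node) (k : ℕ) :
    MeasurableSet {ω | N.best P t Z ω = k} := by
  refine measurableSet_sInf_eq
    (q := fun k ω => ∀ j, N.pathLoss P (.bs t k) Z ω ≤ N.pathLoss P (.bs t j) Z ω) (fun k => ?_) k
  simp only [Set.ofPred_forall]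
  exact MeasurableSet.iInter fun j =>
    measurableSet_le (h.measurable_pathLoss P _ _) (h.measurable_pathLoss P _ _)

lemma measurable_biasedPower (t : Tier) (Z : Node) : Measurable (N.biasedPower P t Z) :=
  measurable_const.div (measurable_countable_choice (h := fun k => N.pathLoss P (.bs t k) Z)
    (h.measurableSet_best_eq P t Z) (fun _ => h.measurable_pathLoss P _ _))

lemma measurableSet_assocTier_eq (Z : Node) (t : Tier) :
    MeasurableSet {ω | N.assocTier P Z ω = t} := by
  have hlt : MeasurableSet {ω | N.biasedPower P .s Z ω < N.biasedPower P .m Z ω} :=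
    measurableSet_lt (h.measurable_biasedPower P _ _) (h.measurable_biasedPower P _ _)
  cases t with
  | m =>
    convert! hlt using 1
    ext ω
    simp [assocTier]
  | s =>
    convert! hlt.compl using 1
    ext ω
    simp [assocTier]

lemma measurableSet_tagTier_eq (t : Tier) : MeasurableSet {ω | N.tagTier P ω = t} :=
  h.measurableSet_assocTier_eq P _ t

lemma measurableSet_serving_eq (Z X : Node) : MeasurableSet {ω | N.serving P Z ω = X} :=
  measurableSet_countable_choice
    (p := fun t ω => Node.bs t (N.best P t Z ω) = X) (h.measurableSet_assocTier_eq P Z)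
    (fun t => measurableSet_countable_choice (p := fun k _ => Node.bs t k = X)
      (h.measurableSet_best_eq P t Z) (fun _ => MeasurableSet.const _))

lemma measurableSet_tagBS_eq (X : Node) : MeasurableSet {ω | N.tagBS P ω = X} :=
  h.measurableSet_serving_eq P _ X

lemma measurableSet_tagIndex_eq (k : ℕ) : MeasurableSet {ω | N.tagIndex P ω = k} :=
  measurableSet_countable_choice (p := fun t ω => N.best P t .origin ω = k)
    (h.measurableSet_tagTier_eq P) (fun t => h.measurableSet_best_eq P t _ k)

lemma measurableSet_tagMBS_eq (k : ℕ) : MeasurableSet {ω | N.tagMBS P ω = k} :=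
  measurableSet_countable_choice (p := fun Z ω => N.best P .m Z ω = k)
    (h.measurableSet_tagBS_eq P) (fun Z => h.measurableSet_best_eq P _ Z k)

lemma measurableSet_lt_load_fst (t : Tier) (k : ℕ) :
    MeasurableSet {ω | 0 < (N.load t k ω).1} :=
  measurableSet_lt measurable_const (measurable_fst.comp (h.load t k))

lemma measurableSet_lt_load_snd (t : Tier) (k : ℕ) :
    MeasurableSet {ω | 0 < (N.load t k ω).2} :=
  measurableSet_lt measurable_const (measurable_snd.comp (h.load t k))

lemma measurable_bsFad (wa : AccessScheme) (f : FrameLengths) (t : Tier) (k : ℕ) :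
    Measurable (N.bsFad wa f t k) := by
  cases wa with
  | static => exact measurable_const
  | dynamic =>
    have hx : Measurable (fun ω => (f.Fa : ℝ) * dlFraction (N.load t k ω).1 (N.load t k ω).2) :=
      (Measurable.of_discrete (f := fun l : ℕ × ℕ => (f.Fa : ℝ) * dlFraction l.1 l.2)).comp
        (h.load t k)
    exact measurable_randRound hx (h.round t k)

lemma measurable_rxPower (i : ℕ) (X Y : Node) : Measurable (N.rxPower P i X Y) :=
  ENNReal.measurable_ofReal.comp
    (((measurable_const.mul (h.fading X Y i)).mul (h.gain X Y i)).div (h.measurable_pathLoss P X Y))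

lemma measurableSet_scheduledUE_eq (t : Tier) (k i : ℕ) (o : Option ℕ) :
    MeasurableSet {ω | N.scheduledUE P t k i ω = o} :=
  measurableSet_uniformPick_eq
    (p := fun j ω => P.eta ≤ N.coin (.ulMark j) ω ∧ N.serving P (.ue j) ω = .bs t k)
    (fun j => (measurableSet_le measurable_const (h.ulMark j)).inter
      (h.measurableSet_serving_eq P _ _)) (h.uePick t k i) o

lemma measurable_accessBSInterference (wa : AccessScheme) (f : FrameLengths) (t : Tier) (i : ℕ)
    (Z : Node) : Measurable (N.accessBSInterference P wa f t i Z) := by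
  refine Measurable.tsum fun k => Measurable.ite ?_ (h.measurable_rxPower P _ _ _)
    measurable_const
  refine MeasurableSet.inter ?_ (MeasurableSet.inter ?_ (h.measurableSet_lt_load_snd _ _))
  · simpa only [eq_comm] using! (h.measurableSet_tagBS_eq P (.bs t k)).compl
  · exact measurableSet_le measurable_const (h.measurable_bsFad wa f t k)

lemma measurable_accessUEInterference (wa : AccessScheme) (f : FrameLengths) (t : Tier) (i : ℕ)
    (Z : Node) : Measurable (N.accessUEInterference P wa f t i Z) := by
  refine Measurable.tsum fun k => Measurable.ite ?_ ?_ measurable_const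
  · refine MeasurableSet.inter ?_ (MeasurableSet.inter ?_
      (MeasurableSet.inter (MeasurableSet.const _) (h.measurableSet_lt_load_fst _ _)))
    · simpa only [eq_comm] using! (h.measurableSet_tagBS_eq P (.bs t k)).compl
    · exact measurableSet_lt (h.measurable_bsFad wa f t k) measurable_const
  · refine measurable_countable_choice
      (h := fun (o : Option ℕ) ω => o.elim 0 (fun j => N.rxPower P i Z (.ue j) ω))
      (h.measurableSet_scheduledUE_eq P t k i) fun o => ?_
    cases o with
    | none => exact measurable_const
    | some j => exact h.measurable_rxPower P _ _ _

lemma measurable_backhaulMBSInterference (f : FrameLengths) (i : ℕ) (Z : Node) :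
    Measurable (N.backhaulMBSInterference P f i Z) := by
  refine Measurable.tsum fun k => Measurable.ite ?_ (h.measurable_rxPower P _ _ _)
    measurable_const
  refine MeasurableSet.inter ?_ (MeasurableSet.inter (MeasurableSet.const _)
    (MeasurableSet.inter (MeasurableSet.const _) ?_))
  · simpa only [eq_comm] using! (h.measurableSet_tagMBS_eq P k).compl
  · exact measurableSet_lt measurable_const (h.loadSD k)

lemma measurableSet_scheduledSBS_eq (p : Prop) (M i : ℕ) (o : Option ℕ) :
    MeasurableSet {ω | N.scheduledSBS P p M i ω = o} := by
  have hpick := measurableSet_uniformPick_eq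
    (p := fun j ω => N.best P .m (.bs .s j) ω = M ∧ 0 < (N.load .s j ω).2 ∧
      Node.bs .s j ≠ N.tagBS P ω)
    (fun j => (h.measurableSet_best_eq P _ _ M).inter ((h.measurableSet_lt_load_snd _ _).inter
      (by simpa only [eq_comm] using! (h.measurableSet_tagBS_eq P (.bs .s j)).compl)))
    (h.sbsPick M i) o
  have htag : MeasurableSet {ω | some (N.tagIndex P ω) = o} :=
    measurableSet_countable_choice (p := fun k _ => some k = o) (h.measurableSet_tagIndex_eq P)
      (fun _ => MeasurableSet.const _)
  have hM : MeasurableSet {ω | M = N.tagMBS P ω ∧ p} :=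
    MeasurableSet.inter (by simpa only [eq_comm] using! h.measurableSet_tagMBS_eq P M)
      (MeasurableSet.const _)
  -- The event splits along the `if` in `scheduledSBS`: the tagged SBS is imposed, or another one is
  -- picked.
  convert! (hM.inter htag).union (hM.compl.inter hpick) using 1
  ext ω
  by_cases hω : M = N.tagMBS P ω ∧ p
  · simp [scheduledSBS, hω]
  · have h1 : ω ∉ {ω | M = N.tagMBS P ω ∧ p} := hω
    simp only [scheduledSBS, Set.mem_ofPred_eq, Set.mem_union, Set.mem_inter_iff,
      Set.mem_compl_iff, h1, hω, false_and, not_false_eq_true, true_and, false_or, if_false]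

lemma measurable_poachingInterference (p : Prop) (f : FrameLengths) (i : ℕ) (Z : Node) :
    Measurable (N.poachingInterference P p f i Z) := by
  refine Measurable.tsum fun k => Measurable.ite ?_ (h.measurable_rxPower P _ _ _)
    measurable_const
  refine MeasurableSet.inter ?_ (MeasurableSet.inter (MeasurableSet.const _)
    (MeasurableSet.inter (MeasurableSet.const _) (MeasurableSet.inter
      (h.measurableSet_lt_load_snd _ _) (MeasurableSet.inter ?_ ?_))))
  · simpa only [eq_comm] using! (h.measurableSet_tagBS_eq P (.bs .s k)).compl
  · exact measurableSet_countable_choice (p := fun M ω => N.scheduledSBS P p M i ω ≠ some k)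
      (h.measurableSet_best_eq P _ _)
      (fun M => (h.measurableSet_scheduledSBS_eq P p M i (some k)).compl)
  · exact measurableSet_lt (h.poach k i) measurable_const

lemma measurable_sinrAccess (wa : AccessScheme) (f : FrameLengths) (i : ℕ) :
    Measurable (N.sinrAccess P wa f i) := by
  refine Measurable.div ?_ (Measurable.add ?_ measurable_const)
  · refine ENNReal.measurable_ofReal.comp ?_
    -- The fading and path loss are evaluated at a random node. Freezing first the tier and then the
    -- node leaves measurable functions with fixed labels.
    refine measurable_countable_choice (h := fun (t : Tier) ω =>
      P.C0 * P.power t.kind * N.fading .origin (N.tagBS P ω) i ω *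
      (P.mainGain .u * P.mainGain t.kind) / N.pathLoss P .origin (N.tagBS P ω) ω)
      (h.measurableSet_tagTier_eq P) fun t => ?_
    refine measurable_countable_choice (h := fun (X : Node) ω =>
      P.C0 * P.power t.kind * N.fading .origin X i ω *
      (P.mainGain .u * P.mainGain t.kind) / N.pathLoss P .origin X ω)
      (h.measurableSet_tagBS_eq P) fun X => ?_
    exact ((measurable_const.mul (h.fading _ _ _)).mul measurable_const).div
      (h.measurable_pathLoss P _ _)
  · split_ifs
    · exact ((h.measurable_accessBSInterference P _ _ _ _ _).add
        (h.measurable_accessBSInterference P _ _ _ _ _)).add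
        ((h.measurable_accessUEInterference P _ _ _ _ _).add
        (h.measurable_accessUEInterference P _ _ _ _ _))
    · exact (h.measurable_backhaulMBSInterference P _ _ _).add
        (h.measurable_poachingInterference P _ _ _ _)

lemma measurable_sinrBackhaul (wb : BackhaulScheme) (f : FrameLengths) (i : ℕ) :
    Measurable (N.sinrBackhaul P wb f i) := by
  refine Measurable.div ?_ (Measurable.add (Measurable.add ?_ ?_) measurable_const)
  · refine ENNReal.measurable_ofReal.comp ?_
    refine measurable_countable_choice (h := fun (X : Node) ω =>
      P.C0 * P.power .m * N.fading X (.bs .m (N.tagMBS P ω)) i ω *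
      (P.mainGain .m * P.mainGain .s) / N.pathLoss P X (.bs .m (N.tagMBS P ω)) ω)
      (h.measurableSet_tagBS_eq P) fun X => ?_
    refine measurable_countable_choice (h := fun (k : ℕ) ω =>
      P.C0 * P.power .m * N.fading X (.bs .m k) i ω *
      (P.mainGain .m * P.mainGain .s) / N.pathLoss P X (.bs .m k) ω)
      (h.measurableSet_tagMBS_eq P) fun k => ?_
    exact ((measurable_const.mul (h.fading _ _ _)).mul measurable_const).div
      (h.measurable_pathLoss P _ _)
  · exact measurable_countable_choice (h := fun X => N.backhaulMBSInterference P f i X)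
      (h.measurableSet_tagBS_eq P) fun X => h.measurable_backhaulMBSInterference P _ _ _
  · cases wb with
    | SAB => exact measurable_const
    | UAB =>
      exact measurable_countable_choice (h := fun X => N.poachingInterference P True f i X)
        (h.measurableSet_tagBS_eq P) fun X => h.measurable_poachingInterference P _ _ _ _

end EnvMeasurable

end Network

/-! ### The three groups of sources and the quantities they generate -/

/-- The coins that determine the common subframe lengths. -/
def frameSources : Set Source := {.coin .frameA, .coin .frameBD, .coin .frameAD}

/-- The sources of the loads and of the scheduling decisions of the tagged base stations. -/
def tagSources : Set Source :=
  {a | match a with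
    | .tagLoad _ => True
    | .tagSD => True
    | .coin .tagRound => True
    | .coin (.tagUePick _) => True
    | .coin (.tagPoach _) => True
    | .coin (.tagSbsPick _) => True
    | .coin (.tagTxPick _) => True
    | _ => False}

/-- The sources of the positions, channels and decisions of the interfering devices. -/
def envSources : Set Source := (frameSources ∪ tagSources)ᶜ

lemma disjoint_env_frame : Disjoint envSources frameSources :=
  Set.disjoint_left.2 fun _ ha hf => ha (Or.inl hf)

lemma disjoint_frame_tag : Disjoint frameSources tagSources := by
  refine Set.disjoint_left.2 fun a ha hf => ?_
  rcases ha with rfl | rfl | rfl <;> exact hf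

/-- This separation makes the SINR and the conditioning event independent of the scheduling
decisions of the tagged base stations. -/
lemma disjoint_base_tag : Disjoint (envSources ∪ frameSources) tagSources :=
  Set.disjoint_union_left.2
    ⟨Set.disjoint_left.2 fun _ ha hf => ha (Or.inr hf), disjoint_frame_tag⟩

namespace Network

variable {Ω : Type*} {N : Network Ω}

/-- The σ-algebra generated by a set of sources of randomness. -/
@[reducible]
def sigmaOf (N : Network Ω) (S : Set Source) : MeasurableSpace Ω := ⨆ a ∈ S, N.sourceSigma a

lemma sourceSigma_le_sigmaOf {S : Set Source} {a : Source} (ha : a ∈ S) :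
    N.sourceSigma a ≤ N.sigmaOf S := le_biSup N.sourceSigma ha

lemma measurable_coin {S : Set Source} {c : Coin} (hc : .coin c ∈ S) :
    Measurable[N.sigmaOf S] (N.coin c) :=
  measurable_iff_comap_le.2 (sourceSigma_le_sigmaOf hc)

lemma measurable_tagLoad {S : Set Source} {t : Tier} (hc : .tagLoad t ∈ S) :
    Measurable[N.sigmaOf S] (N.tagLoad t) :=
  measurable_iff_comap_le.2 (sourceSigma_le_sigmaOf hc)

lemma measurable_tagSD {S : Set Source} (hc : .tagSD ∈ S) :
    Measurable[N.sigmaOf S] N.tagSD :=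
  measurable_iff_comap_le.2 (sourceSigma_le_sigmaOf hc)

lemma envMeasurable (N : Network Ω) {S : Set Source} (hS : envSources ⊆ S) :
    @EnvMeasurable Ω (N.sigmaOf S) N := by
  have hmem : ∀ a, a ∉ frameSources → a ∉ tagSources → a ∈ S := fun a h1 h2 =>
    hS (not_or.2 ⟨h1, h2⟩)
  let _ : MeasurableSpace Ω := N.sigmaOf S
  have hcoin : ∀ c, .coin c ∉ frameSources → .coin c ∉ tagSources → Measurable (N.coin c) :=
    fun c h1 h2 => measurable_coin (hmem _ h1 h2)
  -- Membership of these sources in `tagSources` reduces to `False`, so `id` proves nonmembership.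
  refine ⟨fun k j => ?_, fun _ => hcoin _ ?_ id, fun _ => hcoin _ ?_ id, fun _ _ => hcoin _ ?_ id,
    fun _ _ _ => hcoin _ ?_ id, fun _ _ => hcoin _ ?_ id, fun _ _ => hcoin _ ?_ id,
    fun X Y i => ?_, fun X Y i => ?_, fun t k => ?_, fun k => ?_⟩
  · have : Measurable (fun ω (j : ℕ) => N.pos k j ω) := measurable_iff_comap_le.2
      (sourceSigma_le_sigmaOf (a := .points k) (hmem _ (by simp [frameSources]) id))
    exact (measurable_pi_apply j).comp this
  any_goals simp [frameSources]
  · have : Measurable (fun ω (i : ℕ) => N.fading X Y i ω) := measurable_iff_comap_le.2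
      (sourceSigma_le_sigmaOf (a := .fading X Y) (hmem _ (by simp [frameSources]) id))
    exact (measurable_pi_apply i).comp this
  · have : Measurable (fun ω (i : ℕ) => N.gain X Y i ω) := measurable_iff_comap_le.2
      (sourceSigma_le_sigmaOf (a := .gain X Y) (hmem _ (by simp [frameSources]) id))
    exact (measurable_pi_apply i).comp this
  · exact measurable_iff_comap_le.2
      (sourceSigma_le_sigmaOf (a := .load t k) (hmem _ (by simp [frameSources]) id))
  · exact measurable_iff_comap_le.2
      (sourceSigma_le_sigmaOf (a := .loadSD k) (hmem _ (by simp [frameSources]) id))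

lemma measurable_frame (N : Network Ω) (P : Params) (wa : AccessScheme) {S : Set Source}
    (hS : frameSources ⊆ S) : Measurable[N.sigmaOf S] (N.frame P wa) := by
  let _ : MeasurableSpace Ω := N.sigmaOf S
  have hA : Measurable (N.frameA P) := measurable_randRound measurable_const
    (measurable_coin (hS (by simp [frameSources])))
  have hcast : Measurable (fun ω => (N.frameA P ω : ℝ)) := by fun_prop
  have hBD : Measurable (N.frameBD P) := measurable_randRound (by fun_prop)
    (measurable_coin (hS (by simp [frameSources])))
  have hAD : Measurable (N.frameAD P) := measurable_randRound (by fun_prop)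
    (measurable_coin (hS (by simp [frameSources])))
  cases wa with
  | static =>
    exact (Measurable.of_discrete (f := fun x : ℕ × ℕ × ℕ => FrameLengths.mk x.1 x.2.1 x.2.2)).comp
      (hA.prodMk (hBD.prodMk hAD))
  | dynamic =>
    exact (Measurable.of_discrete (f := fun x : ℕ × ℕ => FrameLengths.mk x.1 x.2 0)).comp
      (hA.prodMk hBD)

lemma measurableSet_frame_eq (N : Network Ω) (P : Params) (wa : AccessScheme) {S : Set Source}
    (hS : frameSources ⊆ S) (f : FrameLengths) :
    MeasurableSet[N.sigmaOf S] {ω | N.frame P wa ω = f} :=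
  N.measurable_frame P wa hS (MeasurableSpace.measurableSet_top (s := {f}))

lemma measurable_sinrAccess_frame (N : Network Ω) (P : Params) (wa : AccessScheme) (i : ℕ)
    {S : Set Source} (hS : envSources ∪ frameSources ⊆ S) :
    Measurable[N.sigmaOf S] (fun ω => N.sinrAccess P wa (N.frame P wa ω) i ω) := by
  let _ : MeasurableSpace Ω := N.sigmaOf S
  exact measurable_countable_choice (h := fun f => N.sinrAccess P wa f i)
    (N.measurableSet_frame_eq P wa (Set.subset_union_right.trans hS))
    fun f => (N.envMeasurable (Set.subset_union_left.trans hS)).measurable_sinrAccess P wa f i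

lemma measurable_sinrBackhaul_frame (N : Network Ω) (P : Params) (wa : AccessScheme)
    (wb : BackhaulScheme) (i : ℕ) {S : Set Source} (hS : envSources ∪ frameSources ⊆ S) :
    Measurable[N.sigmaOf S] (fun ω => N.sinrBackhaul P wb (N.frame P wa ω) i ω) := by
  let _ : MeasurableSpace Ω := N.sigmaOf S
  exact measurable_countable_choice (h := fun f => N.sinrBackhaul P wb f i)
    (N.measurableSet_frame_eq P wa (Set.subset_union_right.trans hS))
    fun f => (N.envMeasurable (Set.subset_union_left.trans hS)).measurable_sinrBackhaul P wb f i

lemma measurableSet_assocEvent (N : Network Ω) (P : Params) {S : Set Source}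
    (hS : envSources ⊆ S) (t : Tier) : MeasurableSet[N.sigmaOf S] (N.assocEvent P t) := by
  let _ : MeasurableSpace Ω := N.sigmaOf S
  exact (N.envMeasurable hS).measurableSet_tagTier_eq P t

lemma measurable_spectralEff : Measurable spectralEff := by
  unfold spectralEff Real.logb
  fun_prop

lemma iUnion_frame_eq (N : Network Ω) (P : Params) (wa : AccessScheme) :
    ⋃ f, {ω | N.frame P wa ω = f} = Set.univ := by
  ext ω
  simp

/-- Positive noise keeps the denominator away from zero, and infinite interference only gives SINR
zero. Finiteness matters because `spectralEff` goes through `toReal`, which sends `∞` to `0`. -/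
lemma sinrAccess_ne_top (N : Network Ω) (P : Params) (wa : AccessScheme) (f : FrameLengths) (i : ℕ)
    (ω : Ω) : N.sinrAccess P wa f i ω ≠ ∞ := by
  refine ENNReal.div_ne_top ENNReal.ofReal_ne_top ?_
  simp [P.noise_pos]

lemma sinrBackhaul_ne_top (N : Network Ω) (P : Params) (wb : BackhaulScheme) (f : FrameLengths)
    (i : ℕ) (ω : Ω) : N.sinrBackhaul P wb f i ω ≠ ∞ := by
  refine ENNReal.div_ne_top ENNReal.ofReal_ne_top ?_
  simp [P.noise_pos]

/-! ### Independence and conditioning on tier and frame -/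

variable {P : Params} [MeasurableSpace Ω] {μ : Measure Ω}

lemma IsModel.sigmaOf_le (hN : N.IsModel P μ) (S : Set Source) :
    N.sigmaOf S ≤ ‹MeasurableSpace Ω› := iSup₂_le fun a _ => hN.measurable a

lemma IsModel.lintegral_mul (hN : N.IsModel P μ) {S T : Set Source} (hd : Disjoint S T)
    {f g : Ω → ℝ≥0∞} (hf : Measurable[N.sigmaOf S] f) (hg : Measurable[N.sigmaOf T] g) :
    ∫⁻ ω, f ω * g ω ∂μ = (∫⁻ ω, f ω ∂μ) * ∫⁻ ω, g ω ∂μ :=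
  lintegral_mul_eq_lintegral_mul_lintegral_of_independent_measurableSpace (hN.sigmaOf_le S)
    (hN.sigmaOf_le T) (indep_iSup_of_disjoint hN.measurable hN.indep hd) hf hg

lemma IsModel.measure_inter (hN : N.IsModel P μ) {S T : Set Source} (hd : Disjoint S T)
    {A B : Set Ω} (hA : MeasurableSet[N.sigmaOf S] A) (hB : MeasurableSet[N.sigmaOf T] B) :
    μ (A ∩ B) = μ A * μ B :=
  (Indep_iff _ _ μ).1 (indep_iSup_of_disjoint hN.measurable hN.indep hd) A B hA hB

lemma IsModel.measurableSet_tagged (hN : N.IsModel P μ) (wa : AccessScheme) (t : Tier)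
    (f : FrameLengths) : MeasurableSet (N.assocEvent P t ∩ {ω | N.frame P wa ω = f}) :=
  (hN.sigmaOf_le _ _ (N.measurableSet_assocEvent P subset_rfl t)).inter
    (hN.sigmaOf_le _ _ (N.measurableSet_frame_eq P wa subset_rfl f))

/-- The conditioning event belongs to the σ-algebra of the environment and frame sources, so its
indicator can be absorbed into `g`; `B` is then independent of the product. The normalizing constant
is the same on both sides, so events of probability zero need no separate treatment. -/
lemma IsModel.lintegral_condTierFrame_mul (hN : N.IsModel P μ) (wa : AccessScheme) (t : Tier)
    (f : FrameLengths) {g B : Ω → ℝ≥0∞}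
    (hg : Measurable[N.sigmaOf (envSources ∪ frameSources)] g)
    (hB : Measurable[N.sigmaOf tagSources] B) :
    ∫⁻ ω, g ω * B ω ∂(N.condTierFrame P μ wa t f) =
      (∫⁻ ω, g ω ∂(N.condTierFrame P μ wa t f)) * ∫⁻ ω, B ω ∂μ := by
  have hE : MeasurableSet[N.sigmaOf (envSources ∪ frameSources)]
      (N.assocEvent P t ∩ {ω | N.frame P wa ω = f}) :=
    MeasurableSet.inter (N.measurableSet_assocEvent P Set.subset_union_left t)
      (N.measurableSet_frame_eq P wa Set.subset_union_right f)
  have hE' := hN.measurableSet_tagged wa t f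
  simp only [condTierFrame, ProbabilityTheory.cond, lintegral_smul_measure, smul_eq_mul]
  rw [← lintegral_indicator hE', ← lintegral_indicator hE', mul_assoc,
    ← hN.lintegral_mul disjoint_base_tag (hg.indicator hE) hB]
  simp only [Set.indicator_mul_left]

lemma IsModel.ae_condTierFrame (hN : N.IsModel P μ) (wa : AccessScheme) (t : Tier)
    (f : FrameLengths) :
    ∀ᵐ ω ∂(N.condTierFrame P μ wa t f), N.tagTier P ω = t ∧ N.frame P wa ω = f :=
  ae_cond_mem (hN.measurableSet_tagged wa t f)

/-- Tier and frame are independent, so the frame keeps its law under conditioning on the tier. Only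
the measures are rewritten, so `g` may be arbitrary. -/
lemma IsModel.setLIntegral_condTier [IsProbabilityMeasure μ] (hN : N.IsModel P μ)
    (wa : AccessScheme) (t : Tier) (f : FrameLengths) (g : Ω → ℝ≥0∞) :
    ∫⁻ ω in {ω | N.frame P wa ω = f}, g ω ∂(N.condTier P μ t) =
      μ {ω | N.frame P wa ω = f} * ∫⁻ ω, g ω ∂(N.condTierFrame P μ wa t f) := by
  have hF := hN.sigmaOf_le _ _ (N.measurableSet_frame_eq P wa subset_rfl f)
  have hE := hN.sigmaOf_le _ _ (N.measurableSet_assocEvent P subset_rfl t)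
  have hind : μ (N.assocEvent P t ∩ {ω | N.frame P wa ω = f}) =
      μ (N.assocEvent P t) * μ {ω | N.frame P wa ω = f} :=
    hN.measure_inter disjoint_env_frame (N.measurableSet_assocEvent P subset_rfl t)
      (N.measurableSet_frame_eq P wa subset_rfl f)
  simp only [condTier, condTierFrame, ProbabilityTheory.cond, Measure.restrict_smul, lintegral_smul_measure,
    smul_eq_mul, Measure.restrict_restrict hF]
  rw [Set.inter_comm {ω | N.frame P wa ω = f}]
  -- For a frame of probability zero both sides vanish; otherwise its probability can be cancelled.
  by_cases h0 : μ {ω | N.frame P wa ω = f} = 0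
  · have : μ.restrict (N.assocEvent P t ∩ {ω | N.frame P wa ω = f}) = 0 :=
      Measure.restrict_eq_zero.2 (measure_mono_null Set.inter_subset_right h0)
    simp [this]
  · rw [hind, ENNReal.mul_inv (Or.inr (measure_ne_top _ _)) (Or.inr h0), ← mul_assoc,
      mul_comm (μ (N.assocEvent P t))⁻¹ (μ {ω | N.frame P wa ω = f})⁻¹, ← mul_assoc,
      ENNReal.mul_inv_cancel h0 (measure_ne_top _ _), one_mul]

lemma IsModel.lintegral_eq_tsum_frame (hN : N.IsModel P μ) (wa : AccessScheme) (ν : Measure Ω)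
    (g : Ω → ℝ≥0∞) :
    ∫⁻ ω, g ω ∂ν = ∑' f, ∫⁻ ω in {ω | N.frame P wa ω = f}, g ω ∂ν := by
  rw [← lintegral_iUnion, iUnion_frame_eq, setLIntegral_univ]
  · exact fun f => hN.sigmaOf_le _ _ (N.measurableSet_frame_eq P wa subset_rfl f)
  · intro f f' hne
    refine Set.disjoint_left.2 fun ω h1 h2 => hne ?_
    exact Eq.trans (Eq.symm h1) h2

lemma IsModel.frameExp_eq (hN : N.IsModel P μ) (wa : AccessScheme) (g : FrameLengths → ℝ≥0∞) :
    N.frameExp P μ wa g = ∑' f, μ {ω | N.frame P wa ω = f} * g f := by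
  rw [frameExp, hN.lintegral_eq_tsum_frame wa]
  refine tsum_congr fun f => ?_
  rw [setLIntegral_congr_fun (g := fun _ => g f)
    (hN.sigmaOf_le _ _ (N.measurableSet_frame_eq P wa subset_rfl f))]
  · rw [setLIntegral_const, mul_comm]
  · intro ω hω
    exact congrArg g hω

/-- This is the tower property over the countable partition by frames. The outer average may use `μ`
itself because the frame does not depend on the tier. -/
lemma IsModel.lintegral_condTier [IsProbabilityMeasure μ] (hN : N.IsModel P μ)
    (wa : AccessScheme) (t : Tier) (g : Ω → ℝ≥0∞) :
    ∫⁻ ω, g ω ∂(N.condTier P μ t) =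
      N.frameExp P μ wa (fun f => ∫⁻ ω, g ω ∂(N.condTierFrame P μ wa t f)) := by
  rw [hN.lintegral_eq_tsum_frame wa, hN.frameExp_eq]
  exact tsum_congr fun f => hN.setLIntegral_condTier wa t f g

lemma IsModel.assocProb_add [IsProbabilityMeasure μ] (hN : N.IsModel P μ) :
    N.assocProb P μ .m + N.assocProb P μ .s = 1 := by
  have h : N.assocEvent P .s = (N.assocEvent P .m)ᶜ := by
    ext ω
    cases hω : N.tagTier P ω <;> simp [assocEvent, hω]
  have hm := hN.sigmaOf_le _ _ (N.measurableSet_assocEvent P subset_rfl .m)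
  rw [assocProb, assocProb, h]
  exact measureReal_add_measureReal_compl hm |>.trans (by simp)

/-! ### The layer cake formula for the mean spectral efficiency -/

/-- Layer cake formula for `log (1 + x)`, the integral of `1 / (1 + t)` from `0` to `x`. Finiteness
of `X` identifies the tail events of `X` with those of `X.toReal`. -/
lemma lintegral_spectralEff {ν : Measure Ω} {X : Ω → ℝ≥0∞} (hX : Measurable X)
    (hfin : ∀ ω, X ω ≠ ∞) :
    ∫⁻ ω, spectralEff (X ω) ∂ν = ENNReal.ofReal (Real.log 2)⁻¹ *
      ∫⁻ τ in Set.Ioi (0 : ℝ), ν {ω | ENNReal.ofReal τ < X ω} / ENNReal.ofReal (1 + τ) := by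
  have hlog : ∀ x : ℝ, 0 ≤ x → ∫ t in (0 : ℝ)..x, (1 + t)⁻¹ = Real.log (1 + x) := by
    intro x hx
    rw [intervalIntegral.integral_comp_add_left (fun t => t⁻¹) 1, integral_inv_of_pos] <;>
      first | simp | linarith
  have hint : ∀ t > 0, IntervalIntegrable (fun t : ℝ => (1 + t)⁻¹) volume 0 t := by
    intro t ht
    refine ContinuousOn.intervalIntegrable ?_
    rw [Set.uIcc_of_le ht.le]
    refine ContinuousOn.inv₀ (by fun_prop) ?_
    intro s hs
    have := hs.1
    positivity
  have key := lintegral_comp_eq_lintegral_meas_lt_mul ν (f := fun ω => (X ω).toReal)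
    (g := fun t : ℝ => (1 + t)⁻¹) (Filter.Eventually.of_forall fun ω => ENNReal.toReal_nonneg)
    hX.ennreal_toReal.aemeasurable hint
    ((ae_restrict_mem measurableSet_Ioi).mono fun t ht => by
      have : (0 : ℝ) < t := ht
      exact inv_nonneg.2 (by positivity))
  have hrhs : ∫⁻ τ in Set.Ioi (0 : ℝ), ν {ω | ENNReal.ofReal τ < X ω} / ENNReal.ofReal (1 + τ) =
      ∫⁻ t in Set.Ioi (0 : ℝ), ν {ω | t < (X ω).toReal} * ENNReal.ofReal (1 + t)⁻¹ := by
    refine setLIntegral_congr_fun measurableSet_Ioi fun t ht => ?_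
    have ht0 : (0 : ℝ) < t := ht
    rw [ENNReal.ofReal_inv_of_pos (by positivity), div_eq_mul_inv]
    congr 3
    ext ω
    exact ENNReal.ofReal_lt_iff_lt_toReal ht0.le (hfin ω)
  rw [hrhs, ← key, ← lintegral_const_mul']
  · refine lintegral_congr fun ω => ?_
    rw [hlog _ ENNReal.toReal_nonneg, spectralEff, Real.logb, div_eq_inv_mul,
      ENNReal.ofReal_mul (by have := Real.log_nonneg (x := 2) (by norm_num); positivity)]
  · exact ENNReal.ofReal_ne_top

end Network

/-! ### The negative binomial series -/

lemma lintegral_rpow_mul_exp {a r : ℝ} (ha : 0 < a) (hr : 0 < r) :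
    ∫⁻ t in Set.Ioi (0 : ℝ), ENNReal.ofReal (t ^ (a - 1) * Real.exp (-(r * t))) =
      ENNReal.ofReal ((1 / r) ^ a * Real.Gamma a) := by
  have h := Real.integral_rpow_mul_exp_neg_mul_Ioi ha hr
  have hpos : 0 < (1 / r) ^ a * Real.Gamma a := by
    have := Real.Gamma_pos_of_pos ha
    positivity
  have hint : IntegrableOn (fun t : ℝ => t ^ (a - 1) * Real.exp (-(r * t))) (Set.Ioi 0) := by
    -- A nonintegrable function would have Bochner integral `0`, while the Gamma integral is
    -- positive.
    by_contra hn
    exact hpos.ne' (h ▸ integral_undef hn)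
  rw [← h, ofReal_integral_eq_lintegral_ofReal hint]
  refine (ae_restrict_mem measurableSet_Ioi).mono fun t ht => ?_
  have : (0 : ℝ) < t := ht
  simp only [Pi.zero_apply]
  positivity

/-- Write `Γ(n + a)` as its integral and exchange sum and integral. The series in `n` becomes `exp
(y * t)`, which turns the weight `exp (-t)` into `exp (-(1 - y) * t)`, and a Gamma integral of rate
`1 - y` remains. -/
lemma tsum_Gamma_mul_pow {a y : ℝ} (ha : 0 < a) (hy0 : 0 ≤ y) (hy1 : y < 1) :
    ∑' n : ℕ, ENNReal.ofReal (Real.Gamma (n + a) / n.factorial * y ^ n) =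
      ENNReal.ofReal ((1 - y) ^ (-a) * Real.Gamma a) := by
  have hterm : ∀ n : ℕ, ENNReal.ofReal (Real.Gamma (n + a) / n.factorial * y ^ n) =
      ∫⁻ t in Set.Ioi (0 : ℝ),
        ENNReal.ofReal ((y * t) ^ n / n.factorial * (t ^ (a - 1) * Real.exp (-t))) := by
    intro n
    have hn : 0 < (n : ℝ) + a := by positivity
    have h := lintegral_rpow_mul_exp hn one_pos
    simp only [div_one, Real.one_rpow, one_mul] at h
    rw [div_mul_eq_mul_div, mul_div_assoc, mul_comm, ENNReal.ofReal_mul (by positivity), ← h,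
      ← lintegral_const_mul' _ _ ENNReal.ofReal_ne_top]
    refine setLIntegral_congr_fun measurableSet_Ioi fun t ht => ?_
    have ht0 : (0 : ℝ) < t := ht
    rw [← ENNReal.ofReal_mul (by positivity), add_sub_assoc, Real.rpow_add ht0, Real.rpow_natCast,
      mul_pow]
    ring_nf
  simp only [hterm]
  rw [← lintegral_tsum]
  · have hr : 0 < 1 - y := by linarith
    rw [Real.rpow_neg hr.le, ← Real.inv_rpow hr.le, ← one_div, ← lintegral_rpow_mul_exp ha hr]
    refine setLIntegral_congr_fun measurableSet_Ioi fun t ht => ?_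
    have ht0 : (0 : ℝ) < t := ht
    have hs : HasSum (fun n : ℕ => (y * t) ^ n / n.factorial) (Real.exp (y * t)) := by
      rw [Real.exp_eq_exp_ℝ]
      exact NormedSpace.expSeries_div_hasSum_exp (y * t)
    have hs' := hs.mul_right (t ^ (a - 1) * Real.exp (-t))
    rw [← ENNReal.ofReal_tsum_of_nonneg (fun n => by positivity) hs'.summable, hs'.tsum_eq]
    congr 1
    rw [mul_left_comm, ← Real.exp_add]
    ring_nf
  · intro n
    fun_prop

/-! ### Load distributions -/

lemma kappaStar_nonneg {eps : ℝ} (h : 0 ≤ eps) (n : ℕ) : 0 ≤ kappaStar eps n := by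
  unfold kappaStar
  split_ifs
  · exact le_rfl
  · have h1 := Real.Gamma_pos_of_pos (s := 3.5) (by norm_num)
    have h2 := Real.Gamma_pos_of_pos (s := n + 3.5) (by positivity)
    positivity

lemma upsilon_nonneg {eta eps : ℝ} (heta : eta ∈ Set.Icc (0 : ℝ) 1) (h : 0 < eps) (n1 n2 : ℕ)
    {k : ℝ} (hk : 0 < k) : 0 ≤ upsilon eta eps n1 n2 k := by
  have h1 := Real.Gamma_pos_of_pos (s := 3.5) (by norm_num)
  have h2 := Real.Gamma_pos_of_pos (s := n1 + n2 + k) (by positivity)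
  have h3 := heta.1
  have h4 : 0 ≤ 1 - eta := by linarith [heta.2]
  unfold upsilon
  positivity

/-- With mean zero the formula degenerates to `0` through division by zero, so it is no probability
law. This is what forces the mean loads to be positive. -/
lemma upsilon_zero (eta : ℝ) (n1 n2 : ℕ) {k : ℝ} (hk : k ≠ 0) : upsilon eta 0 n1 n2 k = 0 := by
  simp [upsilon, Real.zero_rpow hk]

/-- The number of DL users under the joint law of UL and DL users has the law of the number of
users of a tagged base station with thinned mean. -/
lemma tsum_upsilon {eta eps : ℝ} (heta : eta ∈ Set.Icc (0 : ℝ) 1) (heps : 0 < eps) (n2 : ℕ) :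
    ∑' n1 : ℕ, ENNReal.ofReal (upsilon eta eps n1 n2 4.5) =
      ENNReal.ofReal (kappaStar (eta * eps) (n2 + 1)) := by
  have hG := Real.Gamma_pos_of_pos (s := 3.5) (by norm_num)
  obtain ⟨heta0, heta1⟩ := heta
  have h1e : 0 ≤ 1 - eta := by linarith
  -- With this `x` the factor `1 + 3.5 / eps` is `x⁻¹`, and the sum over `n1` is a negative binomial
  -- series of ratio `(1 - eta) * x`; `C` below collects the factors free of `n1`.
  set x : ℝ := eps / (eps + 3.5) with hx
  have hx0 : 0 < x := by positivity
  have hx1 : x < 1 := by rw [hx, div_lt_one (by positivity)]; linarith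
  have hxinv : 1 + 3.5 / eps = x⁻¹ := by rw [hx]; field_simp
  have hy1 : (1 - eta) * x < 1 := by nlinarith
  have hb : 0 < (n2 : ℝ) + 4.5 := by positivity
  set C : ℝ := (3.5 : ℝ) ^ (3.5 : ℝ) / Real.Gamma 3.5 * (eta ^ n2 / n2.factorial) *
    ((eps ^ (4.5 : ℝ))⁻¹ * x ^ ((n2 : ℝ) + 4.5)) with hC
  have hC0 : 0 ≤ C := by positivity
  have hterm : ∀ n1 : ℕ, upsilon eta eps n1 n2 4.5 =
      C * (Real.Gamma (n1 + (n2 + 4.5)) / n1.factorial * ((1 - eta) * x) ^ n1) := by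
    intro n1
    have hpow : (x⁻¹ ^ ((n1 : ℝ) + n2 + 4.5))⁻¹ = x ^ n1 * x ^ ((n2 : ℝ) + 4.5) := by
      rw [Real.inv_rpow hx0.le, inv_inv, add_assoc, Real.rpow_add hx0, Real.rpow_natCast]
    rw [upsilon, hxinv, hC, div_eq_mul_inv (Real.Gamma _), mul_inv, hpow, mul_pow, add_assoc]
    field_simp
  simp only [hterm, ENNReal.ofReal_mul hC0]
  rw [ENNReal.tsum_mul_left, tsum_Gamma_mul_pow hb (by positivity) hy1,
    ← ENNReal.ofReal_mul hC0]
  congr 1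
  have hd : 0 < 3.5 + eta * eps := by positivity
  -- The factor `x` cancels the power of `x` in `C`, and the quotient that remains contains the
  -- thinned mean `eta * eps`.
  have hratio : 1 - (1 - eta) * x = x * ((3.5 + eta * eps) / eps) := by
    rw [hx]
    field_simp
    ring
  have hx' : x ^ ((n2 : ℝ) + 4.5) * (1 - (1 - eta) * x) ^ (-((n2 : ℝ) + 4.5)) =
      eps ^ n2 * eps ^ (4.5 : ℝ) * (3.5 + eta * eps) ^ (-((n2 : ℝ) + 4.5)) := by
    rw [hratio, Real.mul_rpow hx0.le (by positivity), ← mul_assoc, ← Real.rpow_add hx0,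
      add_neg_cancel, Real.rpow_zero, one_mul, Real.div_rpow hd.le heps.le,
      Real.rpow_neg heps.le, div_inv_eq_mul, Real.rpow_add heps, Real.rpow_natCast]
    ring
  have he : eps ^ (4.5 : ℝ) ≠ 0 := by positivity
  -- The typical UE is the extra DL user, so the Gamma argument is `(n2 + 1) + 3.5 = n2 + 4.5`,
  -- matching the parameter `4.5` of `upsilon`.
  have hk : kappaStar (eta * eps) (n2 + 1) =
      (3.5 : ℝ) ^ (3.5 : ℝ) * Real.Gamma (n2 + 4.5) * (eta ^ n2 * eps ^ n2) *
      (3.5 + eta * eps) ^ (-((n2 : ℝ) + 4.5)) / (n2.factorial * Real.Gamma 3.5) := by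
    rw [kappaStar, if_neg (Nat.succ_ne_zero n2), Nat.add_sub_cancel, mul_pow]
    push_cast
    congr 4
    · congr 1
      ring
    · ring
  calc _ = (3.5 : ℝ) ^ (3.5 : ℝ) / Real.Gamma 3.5 * (eta ^ n2 / n2.factorial) *
        (eps ^ (4.5 : ℝ))⁻¹ * Real.Gamma (n2 + 4.5) *
        (x ^ ((n2 : ℝ) + 4.5) * (1 - (1 - eta) * x) ^ (-((n2 : ℝ) + 4.5))) := by
          rw [hC]; ring
    _ = _ := by
      rw [hx', hk]
      field_simp

namespace Network

variable {Ω : Type*} {N : Network Ω}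

/-! ### Measurability of the scheduling decisions of the tagged base stations -/

lemma measurable_indicator_one {S : Set Source} {A : Set Ω} (hA : MeasurableSet[N.sigmaOf S] A) :
    Measurable[N.sigmaOf S] (A.indicator (1 : Ω → ℝ≥0∞)) := by
  let _ : MeasurableSpace Ω := N.sigmaOf S
  exact measurable_one.indicator hA

lemma measurableSet_coin_lt (c : Coin) {S : Set Source} (hc : .coin c ∈ S) (a : ℝ) :
    MeasurableSet[N.sigmaOf S] {ω | N.coin c ω < a} :=
  measurableSet_lt (Network.measurable_coin hc) measurable_const

lemma measurableSet_tagLoad_eq {S : Set Source} {t : Tier} (hS : .tagLoad t ∈ S) (p : ℕ × ℕ) :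
    MeasurableSet[N.sigmaOf S] {ω | N.tagLoad t ω = p} :=
  measurable_tagLoad hS (measurableSet_singleton p)

lemma measurableSet_tagSD_eq {S : Set Source} (hS : .tagSD ∈ S) (n : ℕ) :
    MeasurableSet[N.sigmaOf S] {ω | N.tagSD ω = n} :=
  measurable_tagSD hS (measurableSet_singleton n)

/-- The tagged base station, if of tier `t`, picks the typical UE by the coin `c`. -/
def pickEvent (N : Network Ω) (t : Tier) (c : Coin) : Set Ω :=
  {ω | N.coin c ω < 1 / (((N.tagLoad t ω).2 + 1 : ℕ) : ℝ)}

/-- With the tier fixed, the event involves only one load and one coin. The random tier of the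
tagged BS would bring in the environment and destroy the independence. -/
lemma measurableSet_pickEvent {t : Tier} {c : Coin} {S : Set Source} (hc : .coin c ∈ S)
    (ht : .tagLoad t ∈ S) : MeasurableSet[N.sigmaOf S] (N.pickEvent t c) := by
  let _ : MeasurableSpace Ω := N.sigmaOf S
  exact measurableSet_countable_choice (p := fun (p : ℕ × ℕ) ω =>
    N.coin c ω < 1 / ((p.2 + 1 : ℕ) : ℝ)) (measurableSet_tagLoad_eq ht)
    (fun p => measurableSet_coin_lt c hc _)

lemma measurableSet_sbsScheduled {i : ℕ} {S : Set Source} (hc : .coin (.tagSbsPick i) ∈ S)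
    (ht : .tagSD ∈ S) : MeasurableSet[N.sigmaOf S] {ω | N.sbsScheduled i ω} := by
  let _ : MeasurableSpace Ω := N.sigmaOf S
  exact measurableSet_countable_choice (p := fun (n : ℕ) ω =>
    N.coin (.tagSbsPick i) ω < 1 / (n : ℝ)) (measurableSet_tagSD_eq ht)
    (fun p => measurableSet_coin_lt _ hc _)

variable {P : Params} [MeasurableSpace Ω] {μ : Measure Ω}

/-! ### Conditioning on a discrete variable -/

/-- Freezing: split over the values of `X`; each indicator is independent of the frozen integrand `Ψ
a`. -/
lemma IsModel.lintegral_discrete (hN : N.IsModel P μ) {S T : Set Source} (hd : Disjoint S T)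
    {α : Type*} [Countable α] {X : Ω → α} (hX : ∀ a, MeasurableSet[N.sigmaOf S] {ω | X ω = a})
    {Ψ : α → Ω → ℝ≥0∞} (hΨ : ∀ a, Measurable[N.sigmaOf T] (Ψ a)) :
    ∫⁻ ω, Ψ (X ω) ω ∂μ = ∑' a, μ {ω | X ω = a} * ∫⁻ ω, Ψ a ω ∂μ := by
  have hsplit : ∀ ω, Ψ (X ω) ω = ∑' a, {ω | X ω = a}.indicator 1 ω * Ψ a ω := by
    intro ω
    rw [tsum_eq_single (X ω)]
    · simp
    · intro a ha
      simp [Set.indicator_of_notMem (s := {ω | X ω = a}) (fun h => ha (Eq.symm h))]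
  have hind : ∀ a, Measurable[N.sigmaOf S] ({ω | X ω = a}.indicator (1 : Ω → ℝ≥0∞)) := fun a =>
    measurable_indicator_one (hX a)
  simp only [hsplit]
  rw [lintegral_tsum]
  · refine tsum_congr fun a => ?_
    rw [hN.lintegral_mul hd (hind a) (hΨ a),
      lintegral_indicator_one (hN.sigmaOf_le S _ (hX a))]
  · intro a
    exact ((measurable_one.indicator (hN.sigmaOf_le S _ (hX a))).mul
      ((hΨ a).mono (hN.sigmaOf_le T) le_rfl)).aemeasurable

/-! ### Coins -/

lemma IsModel.measurable_coin (hN : N.IsModel P μ) (c : Coin) : Measurable (N.coin c) :=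
  (Network.measurable_coin (Set.mem_univ _)).mono (hN.sigmaOf_le Set.univ) le_rfl

lemma IsModel.measure_coin_lt (hN : N.IsModel P μ) (c : Coin) {a : ℝ} (ha : a ≤ 1) :
    μ {ω | N.coin c ω < a} = ENNReal.ofReal a := by
  have h : μ {ω | N.coin c ω < a} = μ.map (N.coin c) (Set.Iio a) :=
    (Measure.map_apply (hN.measurable_coin c) measurableSet_Iio).symm
  have hset : Set.Iio a ∩ Set.Icc 0 1 = Set.Ico 0 a := by
    ext x
    simp only [Set.mem_inter_iff, Set.mem_Iio, Set.mem_Icc, Set.mem_Ico]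
    constructor
    · rintro ⟨h1, h2, h3⟩
      exact ⟨h2, h1⟩
    · rintro ⟨h1, h2⟩
      exact ⟨h2, h1, by linarith⟩
  rw [h, hN.coin_law, Measure.restrict_apply measurableSet_Iio, hset, Real.volume_Ico, sub_zero]

lemma IsModel.lintegral_randRound [IsProbabilityMeasure μ] (hN : N.IsModel P μ) (c : Coin) {x : ℝ}
    (hx : 0 ≤ x) (g : ℕ → ℝ≥0∞) :
    ∫⁻ ω, g (randRound x (N.coin c ω)) ∂μ =
      ENNReal.ofReal (x - ⌊x⌋₊) * g ⌈x⌉₊ + ENNReal.ofReal (1 - (x - ⌊x⌋₊)) * g ⌊x⌋₊ := by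
  have hfract : Int.fract x = x - ⌊x⌋₊ := by
    rw [Int.fract, natCast_floor_eq_intCast_floor hx]
  set A : Set Ω := {ω | N.coin c ω < Int.fract x} with hA
  have hAm : MeasurableSet A := measurableSet_lt (hN.measurable_coin c) measurable_const
  have hAμ : μ A = ENNReal.ofReal (x - ⌊x⌋₊) := by
    rw [hN.measure_coin_lt c (Int.fract_lt_one x).le, hfract]
  have hAc : μ Aᶜ = ENNReal.ofReal (1 - (x - ⌊x⌋₊)) := by
    rw [prob_compl_eq_one_sub hAm, hAμ, ← hfract, ENNReal.ofReal_sub _ (Int.fract_nonneg x),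
      ENNReal.ofReal_one]
  rw [← lintegral_add_compl _ hAm,
    setLIntegral_congr_fun (g := fun _ => g (⌊x⌋₊ + 1)) hAm
      (fun ω (hω : N.coin c ω < Int.fract x) => by simp [randRound, hω]),
    setLIntegral_congr_fun (g := fun _ => g ⌊x⌋₊) hAm.compl
      (fun ω (hω : ¬ N.coin c ω < Int.fract x) => by simp [randRound, hω]),
    setLIntegral_const, setLIntegral_const, hAμ, hAc, mul_comm, mul_comm (g ⌊x⌋₊)]
  congr 1
  -- For integer `x` the values `⌊x⌋₊ + 1` and `⌈x⌉₊` differ, but the upper branch has weight zero.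
  rcases eq_or_lt_of_le (Int.fract_nonneg x) with h0 | h0
  · rw [← hfract, ← h0]
    simp
  · congr 2
    refine ((Nat.ceil_eq_iff (Nat.succ_ne_zero _)).2 ⟨?_, ?_⟩).symm
    · rw [Nat.succ_sub_one]
      linarith
    · push_cast
      exact (Nat.lt_floor_add_one x).le

/-! ### Means -/

lemma assocProb_nonneg (t : Tier) : 0 ≤ N.assocProb P μ t := ENNReal.toReal_nonneg

lemma meanSD_nonneg : 0 ≤ N.meanSD P μ := by
  have h1 := P.lam_pos .s
  have h2 := P.lam_pos .m
  have h3 := P.lamU_pos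
  have h4 := P.eta_mem.1
  have h5 := assocProb_nonneg (N := N) (P := P) (μ := μ) .s
  have h6 : (1 + N.assocProb P μ .s * P.lamU * P.eta / (3.5 * P.lam .s)) ^ (-3.5 : ℝ) ≤ 1 := by
    refine Real.rpow_le_one_of_one_le_of_nonpos ?_ (by norm_num)
    have : 0 ≤ N.assocProb P μ .s * P.lamU * P.eta / (3.5 * P.lam .s) := by positivity
    linarith
  unfold meanSD
  have : 0 ≤ 1 - (1 + N.assocProb P μ .s * P.lamU * P.eta / (3.5 * P.lam .s)) ^ (-3.5 : ℝ) := by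
    linarith
  positivity

/-- If the mean were zero, the prescribed law of `tagLoad` would give mass zero to every value in a
countable set, contradicting total mass one. Hence both tiers are chosen with positive probability,
with no geometric argument. -/
lemma IsModel.meanUsers_pos [IsProbabilityMeasure μ] (hN : N.IsModel P μ) (t : Tier) :
    0 < N.meanUsers P μ t := by
  have h0 : 0 ≤ N.meanUsers P μ t := by
    have h1 := P.lam_pos t
    have h2 := P.lamU_pos
    have h3 := assocProb_nonneg (N := N) (P := P) (μ := μ) t
    unfold meanUsers
    positivity
  refine lt_of_le_of_ne h0 fun heq => ?_
  have hzero : ∀ p : ℕ × ℕ, μ {ω | N.tagLoad t ω = p} = 0 := by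
    rintro ⟨n1, n2⟩
    rw [hN.tagLoad_law, ← heq, upsilon_zero _ _ _ (by norm_num), ENNReal.ofReal_zero]
  have huniv : (Set.univ : Set Ω) = ⋃ p, {ω | N.tagLoad t ω = p} := by
    ext ω
    simp
  have h1 : μ (Set.univ : Set Ω) = 0 := by
    rw [huniv]
    exact measure_iUnion_null hzero
  simp at h1

/-! ### Probabilities of the scheduling decisions of the tagged base stations -/

lemma one_div_natCast_le_one (n : ℕ) : 1 / (n : ℝ) ≤ 1 := by
  rcases n.eq_zero_or_pos with rfl | hn
  · simp
  · exact div_le_one_of_le₀ (by exact_mod_cast hn) (by positivity)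

/-- Mean of a function of the load and of the rounding coin of the tagged BS on the event that the
typical UE is picked. -/
lemma IsModel.lintegral_tagLoad (hN : N.IsModel P μ) (t : Tier) {c : Coin}
    (hc : c ≠ .tagRound) {g : ℕ × ℕ → ℝ → ℝ≥0∞} (hg : ∀ p, Measurable (g p)) :
    ∫⁻ ω, g (N.tagLoad t ω) (N.coin .tagRound ω) * (N.pickEvent t c).indicator 1 ω ∂μ =
      ∑' (n1 : ℕ) (n2 : ℕ), ENNReal.ofReal (upsilon P.eta (N.meanUsers P μ t) n1 n2 4.5) *
        ((∫⁻ ω, g (n1, n2) (N.coin .tagRound ω) ∂μ) * ENNReal.ofReal (1 / ((n2 : ℝ) + 1))) := by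
  have hd : Disjoint ({.tagLoad t} : Set Source) {.coin .tagRound, .coin c} := by
    simp
  have hd' : Disjoint ({.coin .tagRound} : Set Source) {.coin c} := by
    simpa using hc.symm
  have hG : ∀ (p : ℕ × ℕ) {S : Set Source}, .coin .tagRound ∈ S →
      Measurable[N.sigmaOf S] (fun ω => g p (N.coin .tagRound ω)) :=
    fun p S hS => (hg p).comp (Network.measurable_coin hS)
  have hI : ∀ (p : ℕ × ℕ) {S : Set Source}, .coin c ∈ S → Measurable[N.sigmaOf S]
      ({ω | N.coin c ω < 1 / ((p.2 + 1 : ℕ) : ℝ)}.indicator (1 : Ω → ℝ≥0∞)) :=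
    fun p S hS => measurable_indicator_one (measurableSet_coin_lt c hS _)
  have h := hN.lintegral_discrete hd (X := N.tagLoad t)
    (Ψ := fun p ω => g p (N.coin .tagRound ω) *
      {ω | N.coin c ω < 1 / ((p.2 + 1 : ℕ) : ℝ)}.indicator 1 ω)
    (measurableSet_tagLoad_eq rfl) (fun p => Measurable.mul (hG p (by simp)) (hI p (by simp)))
  refine Eq.trans ?_ (h.trans ?_)
  -- Putting the actual load into the frozen indicator gives back `pickEvent` by definition.
  · rfl
  · rw [ENNReal.tsum_prod']
    refine tsum_congr fun n1 => tsum_congr fun n2 => ?_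
    rw [hN.tagLoad_law, hN.lintegral_mul hd' (hG _ (by simp)) (hI _ (by simp)),
      lintegral_indicator_one (hN.sigmaOf_le _ _
        (measurableSet_coin_lt c (Set.mem_singleton _) _)),
      hN.measure_coin_lt c (one_div_natCast_le_one _)]
    push_cast
    rfl

/-- Given that `tagSD` equals `n`, the coin succeeds with probability `1 / n`; averaging gives the
series `invSD`. The term `n = 0` is zero on both sides. -/
lemma IsModel.measure_sbsScheduled [IsProbabilityMeasure μ] (hN : N.IsModel P μ) (i : ℕ) :
    μ {ω | N.sbsScheduled i ω} = ENNReal.ofReal (N.invSD P μ) := by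
  have hd : Disjoint ({.tagSD} : Set Source) {.coin (.tagSbsPick i)} := by simp
  have h := hN.lintegral_discrete hd (X := N.tagSD)
    (Ψ := fun n ω => {ω | N.coin (.tagSbsPick i) ω < 1 / (n : ℝ)}.indicator 1 ω)
    (measurableSet_tagSD_eq rfl) (fun n => measurable_indicator_one
      (measurableSet_coin_lt _ (Set.mem_singleton _) _))
  have hm : MeasurableSet {ω | N.sbsScheduled i ω} := hN.sigmaOf_le Set.univ _
    (measurableSet_sbsScheduled (Set.mem_univ _) (Set.mem_univ _))
  have hk : ∀ n, 0 ≤ kappaStar (N.meanSD P μ) n := kappaStar_nonneg meanSD_nonneg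
  have hterm : ∀ n : ℕ, μ {ω | N.tagSD ω = n} *
      ∫⁻ ω, {ω | N.coin (.tagSbsPick i) ω < 1 / (n : ℝ)}.indicator 1 ω ∂μ =
      ENNReal.ofReal (kappaStar (N.meanSD P μ) n / n) := by
    intro n
    rw [hN.tagSD_law, lintegral_indicator_one (hN.sigmaOf_le Set.univ _
        (measurableSet_coin_lt _ (Set.mem_univ _) _)),
      hN.measure_coin_lt _ (one_div_natCast_le_one _), ← ENNReal.ofReal_mul (hk n), mul_one_div]
  simp only [hterm] at h
  have hlhs : μ {ω | N.sbsScheduled i ω} =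
      ∑' n : ℕ, ENNReal.ofReal (kappaStar (N.meanSD P μ) n / n) :=
    (lintegral_indicator_one hm).symm.trans h
  have hpos : ∀ n : ℕ, 0 ≤ kappaStar (N.meanSD P μ) n / n :=
    fun n => div_nonneg (hk n) n.cast_nonneg
  -- The series in `ℝ≥0∞` is a probability, hence finite. Without summability the real `tsum` would
  -- take its default value `0`.
  have hsum : Summable (fun n : ℕ => kappaStar (N.meanSD P μ) n / n) := by
    have := ENNReal.summable_toReal (hlhs ▸ measure_ne_top μ {ω | N.sbsScheduled i ω})
    simpa only [ENNReal.toReal_ofReal (hpos _)] using this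
  rw [hlhs, invSD, ENNReal.ofReal_tsum_of_nonneg hpos hsum]

/-- Given `n2` other DL users the pick has probability `1 / (n2 + 1)`. Summing out the UL users by
`tsum_upsilon` leaves `kappaStar` at `n2 + 1`. -/
lemma IsModel.measure_pickEvent [IsProbabilityMeasure μ] (hN : N.IsModel P μ) {c : Coin}
    (hc : c ≠ .tagRound) : μ (N.pickEvent .s c) = ENNReal.ofReal (N.invDL P μ) := by
  have hm : MeasurableSet (N.pickEvent .s c) := hN.sigmaOf_le Set.univ _
    (measurableSet_pickEvent (Set.mem_univ _) (Set.mem_univ _))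
  have h := hN.lintegral_tagLoad .s hc (g := fun _ _ => 1) (fun _ => measurable_const)
  simp only [one_mul, lintegral_one, measure_univ] at h
  have heps := hN.meanUsers_pos .s
  have hmean : N.meanDL P μ .s = P.eta * N.meanUsers P μ .s := by
    unfold meanDL meanUsers
    ring
  have hk : ∀ n, 0 ≤ kappaStar (N.meanDL P μ .s) n := by
    refine kappaStar_nonneg ?_
    rw [hmean]
    exact mul_nonneg P.eta_mem.1 heps.le
  have hlhs : μ (N.pickEvent .s c) =
      ∑' n : ℕ, ENNReal.ofReal (kappaStar (N.meanDL P μ .s) n / n) := by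
    have h0 : kappaStar (N.meanDL P μ .s) 0 = 0 := if_pos rfl
    -- Splitting off the zero term of the `kappaStar` series aligns `n2 + 1` with its index.
    rw [← lintegral_indicator_one hm, h, ENNReal.tsum_comm, tsum_eq_zero_add' (f := fun n : ℕ =>
      ENNReal.ofReal (kappaStar (N.meanDL P μ .s) n / n)) ENNReal.summable]
    simp only [ENNReal.tsum_mul_right, tsum_upsilon P.eta_mem heps, ← hmean, h0, zero_div,
      ENNReal.ofReal_zero, zero_add]
    refine tsum_congr fun n => ?_
    rw [← ENNReal.ofReal_mul (hk (n + 1))]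
    push_cast
    rw [mul_one_div]
  have hpos : ∀ n : ℕ, 0 ≤ kappaStar (N.meanDL P μ .s) n / n :=
    fun n => div_nonneg (hk n) n.cast_nonneg
  have hsum : Summable (fun n : ℕ => kappaStar (N.meanDL P μ .s) n / n) := by
    have := ENNReal.summable_toReal (hlhs ▸ measure_ne_top μ (N.pickEvent .s c))
    simpa only [ENNReal.toReal_ofReal (hpos _)] using this
  rw [hlhs, invDL, ENNReal.ofReal_tsum_of_nonneg hpos hsum]

end Network

/-! ### Mean data per frame -/

/-- Coverage decreases in the threshold, and monotonicity supplies the measurability needed to split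
the integral. -/
lemma coverageIntegral_eq_sum {S : ℕ → ℝ → ℝ≥0∞} (hS : ∀ i, Antitone (S i)) (a b : ℕ) :
    coverageIntegral S a b =
      ∑ i ∈ Finset.Icc a b, ∫⁻ τ in Set.Ioi (0 : ℝ), S i τ / ENNReal.ofReal (1 + τ) := by
  unfold coverageIntegral
  rw [← lintegral_finsetSum]
  · simp only [div_eq_mul_inv, Finset.sum_mul]
  · intro i _
    exact (hS i).measurable.div (by fun_prop)

/-- Conditional expectation preserves integrals over sets of the smaller σ-algebra, and the integral
of a minimum is at most either integral. -/
lemma setLIntegral_min_condLExp_le {Ω : Type*} {m m0 : MeasurableSpace Ω} (hm : m ≤ m0)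
    (ν : Measure Ω) [IsFiniteMeasure ν] (X Y : Ω → ℝ≥0∞) {A : Set Ω} (hA : MeasurableSet[m] A) :
    ∫⁻ ω in A, min (condLExp m ν X ω) (condLExp m ν Y ω) ∂ν ≤
      min (∫⁻ ω in A, X ω ∂ν) (∫⁻ ω in A, Y ω ∂ν) := by
  rw [← setLIntegral_condLExp hm ν X hA, ← setLIntegral_condLExp hm ν Y hA]
  exact le_min (lintegral_mono fun ω => min_le_left _ _) (lintegral_mono fun ω => min_le_right _ _)

/-- Number of DL access slots of the tagged BS as a function of the common subframe lengths, of its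
numbers of UL and of further DL users, and of the rounding coin. -/
noncomputable def tagFadOf (wa : AccessScheme) (f : FrameLengths) (p : ℕ × ℕ) (v : ℝ) : ℕ :=
  match wa with
  | .static => f.Fad
  | .dynamic => randRound (f.Fa * dlFraction p.1 (p.2 + 1)) v

lemma measurable_tagFadOf (wa : AccessScheme) (f : FrameLengths) (p : ℕ × ℕ) :
    Measurable (tagFadOf wa f p) := by
  cases wa with
  | static => exact measurable_const
  | dynamic => exact measurable_randRound measurable_const measurable_id

namespace Network

variable {Ω : Type*} {N : Network Ω} {P : Params} [MeasurableSpace Ω] {μ : Measure Ω}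

lemma antitone_covAccess (wa : AccessScheme) (t : Tier) (f : FrameLengths) (i : ℕ) :
    Antitone (N.covAccess P μ wa t f i) := fun _ _ hab =>
  measure_mono fun _ hω => lt_of_le_of_lt (ENNReal.ofReal_le_ofReal hab) hω

lemma antitone_covBackhaul (wa : AccessScheme) (wb : BackhaulScheme) (f : FrameLengths) (i : ℕ) :
    Antitone (N.covBackhaul P μ wa wb f i) := fun _ _ hab =>
  measure_mono fun _ hω => lt_of_le_of_lt (ENNReal.ofReal_le_ofReal hab) hω

lemma IsModel.lintegral_spectralEff_access (hN : N.IsModel P μ) (wa : AccessScheme) (t : Tier)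
    (f : FrameLengths) (i : ℕ) :
    ∫⁻ ω, spectralEff (N.sinrAccess P wa (N.frame P wa ω) i ω) ∂(N.condTierFrame P μ wa t f) =
      ENNReal.ofReal (Real.log 2)⁻¹ *
        ∫⁻ τ in Set.Ioi (0 : ℝ), N.covAccess P μ wa t f i τ / ENNReal.ofReal (1 + τ) :=
  lintegral_spectralEff
    ((N.measurable_sinrAccess_frame P wa i subset_rfl).mono (hN.sigmaOf_le _) le_rfl)
    (fun ω => N.sinrAccess_ne_top P wa _ i ω)

lemma IsModel.lintegral_spectralEff_backhaul (hN : N.IsModel P μ) (wa : AccessScheme)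
    (wb : BackhaulScheme) (f : FrameLengths) (i : ℕ) :
    ∫⁻ ω, spectralEff (N.sinrBackhaul P wb (N.frame P wa ω) i ω) ∂(N.condTierFrame P μ wa .s f) =
      ENNReal.ofReal (Real.log 2)⁻¹ *
        ∫⁻ τ in Set.Ioi (0 : ℝ), N.covBackhaul P μ wa wb f i τ / ENNReal.ofReal (1 + τ) :=
  lintegral_spectralEff
    ((N.measurable_sinrBackhaul_frame P wa wb i subset_rfl).mono (hN.sigmaOf_le _) le_rfl)
    (fun ω => N.sinrBackhaul_ne_top P wb _ i ω)

lemma IsModel.tagFadMean_eq [IsProbabilityMeasure μ] (hN : N.IsModel P μ) (wa : AccessScheme)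
    (f : FrameLengths) (n1 n2 : ℕ) (g : ℕ → ℝ≥0∞) :
    tagFadMean wa f n1 n2 g = ∫⁻ ω, g (tagFadOf wa f (n1, n2) (N.coin .tagRound ω)) ∂μ := by
  cases wa with
  | static => simp [tagFadMean, tagFadOf]
  | dynamic =>
    have hx : 0 ≤ (f.Fa : ℝ) * dlFraction n1 (n2 + 1) := by
      unfold dlFraction
      positivity
    exact (hN.lintegral_randRound .tagRound hx g).symm

/-- Mean access data, given the serving tier and the common subframe lengths. -/
lemma IsModel.lintegral_dataAccess [IsProbabilityMeasure μ] (hN : N.IsModel P μ)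
    (wa : AccessScheme) (t : Tier) (f : FrameLengths) :
    ∫⁻ ω, N.dataAccess P wa ω ∂(N.condTierFrame P μ wa t f) =
      ENNReal.ofReal (P.bw * P.T / Real.log 2) * N.accessSum P μ wa t f := by
  set U : ℕ → Ω → ℝ≥0∞ := fun i ω => spectralEff (N.sinrAccess P wa (N.frame P wa ω) i ω) with hU
  set J : ℕ → ℝ≥0∞ := fun i =>
    ∫⁻ τ in Set.Ioi (0 : ℝ), N.covAccess P μ wa t f i τ / ENNReal.ofReal (1 + τ) with hJ
  -- The indicator that slot `i` is a DL access slot turns the sum of random length into a series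
  -- over all `i`. In each term `U i` depends on environment and frame, and `B i` on the tag
  -- sources.
  set K : ℕ → ℕ × ℕ → ℝ → ℝ≥0∞ := fun i p v =>
    if i ∈ Finset.Icc 1 (tagFadOf wa f p v) then 1 else 0 with hK
  set B : ℕ → Ω → ℝ≥0∞ := fun i ω => K i (N.tagLoad t ω) (N.coin .tagRound ω) *
    (N.pickEvent t (.tagUePick i)).indicator 1 ω with hB
  have hKm : ∀ i p, Measurable (K i p) := fun i p =>
    (measurable_from_top (f := fun n : ℕ => if i ∈ Finset.Icc 1 n then (1 : ℝ≥0∞) else 0)).comp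
      (measurable_tagFadOf wa f p)
  have hUm : ∀ i, Measurable[N.sigmaOf (envSources ∪ frameSources)] (U i) := fun i =>
    measurable_spectralEff.comp (N.measurable_sinrAccess_frame P wa i subset_rfl)
  have hBm : ∀ i, Measurable[N.sigmaOf tagSources] (B i) := by
    intro i
    let _ : MeasurableSpace Ω := N.sigmaOf tagSources
    refine Measurable.mul ?_ (measurable_indicator_one (measurableSet_pickEvent trivial trivial))
    exact measurable_countable_choice (h := fun p ω => K i p (N.coin .tagRound ω))
      (measurableSet_tagLoad_eq (N := N) (S := tagSources) (t := t) trivial) fun p =>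
        (hKm i p).comp (Network.measurable_coin trivial)
  have hdata : ∀ᵐ ω ∂(N.condTierFrame P μ wa t f), N.dataAccess P wa ω =
      ENNReal.ofReal (P.bw * P.T) * ∑' i, U i ω * B i ω := by
    filter_upwards [hN.ae_condTierFrame wa t f] with ω hω
    obtain ⟨ht, hf⟩ := hω
    have hFad : N.tagFad P wa ω = tagFadOf wa f (N.tagLoad t ω) (N.coin .tagRound ω) := by
      cases wa <;> simp [tagFad, tagFadOf, hf, tagUL, tagDL, ht]
    have hpick : ∀ i, N.uePicked P i ω ↔ ω ∈ N.pickEvent t (.tagUePick i) := by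
      intro i
      simp [uePicked, pickEvent, tagDL, ht]
    rw [dataAccess, hFad, tsum_eq_sum
      (s := Finset.Icc 1 (tagFadOf wa f (N.tagLoad t ω) (N.coin .tagRound ω)))]
    · congr 1
      refine Finset.sum_congr rfl fun i hi => ?_
      simp only [hB, hK, if_pos hi, one_mul, hpick]
      by_cases h : ω ∈ N.pickEvent t (.tagUePick i) <;> simp [h, hU]
    · intro i hi
      simp only [hB, hK, if_neg hi, zero_mul, mul_zero]
  have hmeas : ∀ i, AEMeasurable (fun ω => U i ω * B i ω) (N.condTierFrame P μ wa t f) := fun i =>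
    (((hUm i).mono (hN.sigmaOf_le _) le_rfl).mul
      ((hBm i).mono (hN.sigmaOf_le _) le_rfl)).aemeasurable
  have hBint : ∀ i, ∫⁻ ω, B i ω ∂μ =
      ∑' (n1 : ℕ) (n2 : ℕ), ENNReal.ofReal (upsilon P.eta (N.meanUsers P μ t) n1 n2 4.5) *
        ((∫⁻ ω, K i (n1, n2) (N.coin .tagRound ω) ∂μ) * ENNReal.ofReal (1 / ((n2 : ℝ) + 1))) :=
    fun i => hN.lintegral_tagLoad t (by simp) (hKm i)
  -- The same indicators expand the formula side, whose coverage integral has a random upper limit,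
  -- into a series over `i`.
  have hfad : ∀ n1 n2 : ℕ, tagFadMean wa f n1 n2
      (fun b => coverageIntegral (N.covAccess P μ wa t f) 1 b) =
      ∑' i, J i * ∫⁻ ω, K i (n1, n2) (N.coin .tagRound ω) ∂μ := by
    intro n1 n2
    have hKc : ∀ i, Measurable (fun ω => K i (n1, n2) (N.coin .tagRound ω)) := fun i =>
      (hKm i _).comp (hN.measurable_coin _)
    simp only [hN.tagFadMean_eq, ← lintegral_const_mul _ (hKc _)]
    rw [← lintegral_tsum fun i => ((hKc i).const_mul _).aemeasurable]
    refine lintegral_congr fun ω => ?_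
    rw [coverageIntegral_eq_sum (antitone_covAccess wa t f),
      tsum_eq_sum (s := Finset.Icc 1 (tagFadOf wa f (n1, n2) (N.coin .tagRound ω)))]
    · refine Finset.sum_congr rfl fun i hi => ?_
      simp only [hK, if_pos hi, mul_one, hJ]
    · intro i hi
      simp only [hK, if_neg hi, mul_zero]
  have hlog := Real.log_nonneg (x := 2) (by norm_num)
  have hUp : ∀ n1 n2, 0 ≤ upsilon P.eta (N.meanUsers P μ t) n1 n2 4.5 := fun n1 n2 =>
    upsilon_nonneg P.eta_mem (hN.meanUsers_pos t) n1 n2 (by norm_num)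
  rw [lintegral_congr_ae hdata, lintegral_const_mul' _ _ ENNReal.ofReal_ne_top,
    lintegral_tsum hmeas, div_eq_mul_inv,
    ENNReal.ofReal_mul (mul_nonneg P.bw_pos.le P.T_pos.le), mul_assoc]
  congr 1
  have hterm : ∀ i, ∫⁻ ω, U i ω * B i ω ∂(N.condTierFrame P μ wa t f) =
      ENNReal.ofReal (Real.log 2)⁻¹ * (J i * ∫⁻ ω, B i ω ∂μ) := fun i => by
    rw [hN.lintegral_condTierFrame_mul wa t f (hUm i) (hBm i),
      hN.lintegral_spectralEff_access wa t f i, mul_assoc]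
  simp only [hterm, hBint]
  rw [ENNReal.tsum_mul_left]
  congr 1
  -- Both sides are now triple series over the load and the slot, and nonnegative series may be
  -- reordered freely.
  simp only [← ENNReal.tsum_mul_left, accessSum, hfad]
  rw [ENNReal.tsum_comm]
  refine tsum_congr fun n1 => ?_
  rw [ENNReal.tsum_comm]
  refine tsum_congr fun n2 => tsum_congr fun i => ?_
  rw [div_eq_mul_one_div (upsilon _ _ _ _ _), ENNReal.ofReal_mul (hUp n1 n2)]
  ring

lemma IsModel.lintegral_indicator_tag (hN : N.IsModel P μ) (wa : AccessScheme) (t : Tier)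
    (f : FrameLengths) {U : Ω → ℝ≥0∞} {A : Set Ω}
    (hU : Measurable[N.sigmaOf (envSources ∪ frameSources)] U)
    (hA : MeasurableSet[N.sigmaOf tagSources] A) :
    ∫⁻ ω, A.indicator U ω ∂(N.condTierFrame P μ wa t f) =
      (∫⁻ ω, U ω ∂(N.condTierFrame P μ wa t f)) * μ A := by
  rw [← lintegral_indicator_one (hN.sigmaOf_le _ _ hA),
    ← hN.lintegral_condTierFrame_mul wa t f hU (measurable_indicator_one hA)]
  refine lintegral_congr fun ω => ?_
  by_cases h : ω ∈ A <;> simp [h]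

/-- Mean data served in a range of slots, in each of which the typical UE is served with the same
probability, independently of the SINR. -/
lemma IsModel.lintegral_sum_served (hN : N.IsModel P μ) (wa : AccessScheme) (t : Tier)
    (f : FrameLengths) {U : ℕ → Ω → ℝ≥0∞} {A : ℕ → Set Ω} {S : ℕ → ℝ → ℝ≥0∞} {q : ℝ≥0∞}
    (hU : ∀ i, Measurable[N.sigmaOf (envSources ∪ frameSources)] (U i))
    (hA : ∀ i, MeasurableSet[N.sigmaOf tagSources] (A i)) (hS : ∀ i, Antitone (S i))
    (hUS : ∀ i, ∫⁻ ω, U i ω ∂(N.condTierFrame P μ wa t f) = ENNReal.ofReal (Real.log 2)⁻¹ *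
      ∫⁻ τ in Set.Ioi (0 : ℝ), S i τ / ENNReal.ofReal (1 + τ))
    (hq : ∀ i, μ (A i) = q) (a b : ℕ) :
    ∫⁻ ω, ENNReal.ofReal (P.bw * P.T) * ∑ i ∈ Finset.Icc a b, (A i).indicator (U i) ω
        ∂(N.condTierFrame P μ wa t f) =
      ENNReal.ofReal (P.bw * P.T / Real.log 2) * q * coverageIntegral S a b := by
  have hm : ∀ i ∈ Finset.Icc a b, Measurable ((A i).indicator (U i)) := fun i _ =>
    ((hU i).mono (hN.sigmaOf_le _) le_rfl).indicator (hN.sigmaOf_le _ _ (hA i))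
  rw [lintegral_const_mul' _ _ ENNReal.ofReal_ne_top, lintegral_finsetSum _ hm,
    coverageIntegral_eq_sum hS, div_eq_mul_inv,
    ENNReal.ofReal_mul (mul_nonneg P.bw_pos.le P.T_pos.le), mul_assoc, mul_assoc]
  congr 1
  simp only [hN.lintegral_indicator_tag wa t f (hU _) (hA _), hUS, hq, Finset.mul_sum]
  exact Finset.sum_congr rfl fun i _ => by ring

lemma invSD_nonneg : 0 ≤ N.invSD P μ :=
  tsum_nonneg fun n => div_nonneg (kappaStar_nonneg meanSD_nonneg n) n.cast_nonneg

/-- Scheduling of the SBS and choice of the UE whose data is sent use disjoint loads and coins, so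
the probabilities multiply. -/
lemma IsModel.measure_backhaulServed [IsProbabilityMeasure μ] (hN : N.IsModel P μ) (i : ℕ) :
    μ ({ω | N.sbsScheduled i ω} ∩ N.pickEvent .s (.tagTxPick i)) =
      ENNReal.ofReal (N.invSD P μ) * ENNReal.ofReal (N.invDL P μ) := by
  have hd : Disjoint ({.tagSD, .coin (.tagSbsPick i)} : Set Source)
      {.tagLoad .s, .coin (.tagTxPick i)} := by simp
  rw [hN.measure_inter hd (measurableSet_sbsScheduled (by simp) (by simp))
    (measurableSet_pickEvent (by simp) (by simp)), hN.measure_sbsScheduled,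
    hN.measure_pickEvent (by simp)]

/-- Three independent decisions: the MBS does not schedule the SBS, the SBS decides to poach, and
the SBS picks the typical UE. -/
lemma IsModel.measure_poached [IsProbabilityMeasure μ] (hN : N.IsModel P μ) (i : ℕ) :
    μ (({ω | N.sbsScheduled i ω}ᶜ ∩ {ω | N.coin (.tagPoach i) ω < P.pdl}) ∩
        N.pickEvent .s (.tagUePick i)) =
      ENNReal.ofReal (1 - N.invSD P μ) * ENNReal.ofReal P.pdl * ENNReal.ofReal (N.invDL P μ) := by
  have hd : Disjoint ({.tagSD, .coin (.tagSbsPick i), .coin (.tagPoach i)} : Set Source)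
      {.tagLoad .s, .coin (.tagUePick i)} := by simp
  have hd' : Disjoint ({.tagSD, .coin (.tagSbsPick i)} : Set Source) {.coin (.tagPoach i)} := by
    simp
  have hsched : MeasurableSet {ω | N.sbsScheduled i ω} := hN.sigmaOf_le Set.univ _
    (measurableSet_sbsScheduled (Set.mem_univ _) (Set.mem_univ _))
  rw [hN.measure_inter hd (MeasurableSet.inter
      (MeasurableSet.compl (measurableSet_sbsScheduled (by simp) (by simp)))
      (measurableSet_coin_lt _ (by simp) _)) (measurableSet_pickEvent (by simp) (by simp)),
    hN.measure_inter hd' (MeasurableSet.compl (measurableSet_sbsScheduled (by simp) (by simp)))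
      (measurableSet_coin_lt _ (by simp) _), prob_compl_eq_one_sub hsched, hN.measure_sbsScheduled,
    hN.measure_pickEvent (by simp), hN.measure_coin_lt _ P.pdl_mem.2,
    ENNReal.ofReal_sub _ invSD_nonneg, ENNReal.ofReal_one]

lemma IsModel.invSD_le_one [IsProbabilityMeasure μ] (hN : N.IsModel P μ) : N.invSD P μ ≤ 1 := by
  have h := hN.measure_sbsScheduled 0
  have h1 : ENNReal.ofReal (N.invSD P μ) ≤ 1 := h ▸ prob_le_one
  simpa using h1

lemma bw_mul_T_div_log_nonneg (P : Params) : 0 ≤ P.bw * P.T / Real.log 2 :=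
  div_nonneg (mul_nonneg P.bw_pos.le P.T_pos.le) (Real.log_nonneg (by norm_num))

lemma IsModel.lintegral_dataPoached [IsProbabilityMeasure μ] (hN : N.IsModel P μ)
    (wa : AccessScheme) (f : FrameLengths) :
    ∫⁻ ω, N.dataPoached P wa ω ∂(N.condTierFrame P μ wa .s f) =
      ENNReal.ofReal (P.bw * P.T / Real.log 2 * (1 - N.invSD P μ) * P.pdl * N.invDL P μ) *
        coverageIntegral (N.covAccess P μ wa .s f) (1 + f.Fa) (f.Fa + f.Fbd) := by
  have h0 := bw_mul_T_div_log_nonneg P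
  have h1 : 0 ≤ 1 - N.invSD P μ := sub_nonneg.2 hN.invSD_le_one
  have h2 := P.pdl_mem.1
  have key := hN.lintegral_sum_served wa .s f
    (fun i => measurable_spectralEff.comp (N.measurable_sinrAccess_frame P wa i subset_rfl))
    (fun i => MeasurableSet.inter (MeasurableSet.inter
      (MeasurableSet.compl (measurableSet_sbsScheduled (i := i) trivial trivial))
      (measurableSet_coin_lt (S := tagSources) (.tagPoach i) trivial P.pdl))
      (measurableSet_pickEvent (t := .s) (c := .tagUePick i) trivial trivial))
    (antitone_covAccess wa .s f) (hN.lintegral_spectralEff_access wa .s f) hN.measure_poached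
    (1 + f.Fa) (f.Fa + f.Fbd)
  -- Splitting `ENNReal.ofReal` over the product needs nonnegative left factors; for `1 - invSD`
  -- this holds because `invSD` is a probability.
  rw [ENNReal.ofReal_mul (by positivity), ENNReal.ofReal_mul (by positivity),
    ENNReal.ofReal_mul h0]
  refine Eq.trans (lintegral_congr_ae ?_) (key.trans (by ring))
  filter_upwards [hN.ae_condTierFrame wa .s f] with ω hω
  obtain ⟨ht, hf⟩ := hω
  rw [dataPoached, hf, add_comm f.Fa 1]
  congr 1
  refine Finset.sum_congr rfl fun i _ => ?_
  simp only [Set.indicator_apply]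
  refine if_congr ?_ (by simp [hf]) rfl
  simp [poaches, uePicked, pickEvent, tagDL, ht]

/-- Mean backhaul data, given the common subframe lengths. -/
lemma IsModel.meanDataSB_eq [IsProbabilityMeasure μ] (hN : N.IsModel P μ)
    (wa : AccessScheme) (wb : BackhaulScheme) (f : FrameLengths) :
    N.meanDataSB P μ wa wb f = N.formulaSB P μ wa wb f := by
  have h0 := bw_mul_T_div_log_nonneg P
  have h1 : 0 ≤ N.invSD P μ := invSD_nonneg
  have key := hN.lintegral_sum_served wa .s f
    (fun i => measurable_spectralEff.comp (N.measurable_sinrBackhaul_frame P wa wb i subset_rfl))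
    (fun i => MeasurableSet.inter (measurableSet_sbsScheduled (i := i) trivial trivial)
      (measurableSet_pickEvent (t := .s) (c := .tagTxPick i) trivial trivial))
    (antitone_covBackhaul wa wb f) (hN.lintegral_spectralEff_backhaul wa wb f)
    hN.measure_backhaulServed (1 + f.Fa) (f.Fa + f.Fbd)
  rw [meanDataSB, formulaSB, ENNReal.ofReal_mul (by positivity), ENNReal.ofReal_mul h0]
  refine Eq.trans (lintegral_congr_ae ?_) (key.trans (by ring))
  filter_upwards [hN.ae_condTierFrame wa .s f] with ω hω
  obtain ⟨ht, hf⟩ := hω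
  rw [dataSB, hf, add_comm f.Fa 1]
  congr 1
  refine Finset.sum_congr rfl fun i _ => ?_
  simp only [Set.indicator_apply]
  refine if_congr ?_ (by simp [hf]) rfl
  simp [backhaulServed, pickEvent, tagDL, ht]

/-- Additivity of the integral needs measurability of only one summand; this one spares a proof for
`dataAccess`. -/
lemma IsModel.measurable_dataPoached (hN : N.IsModel P μ) (wa : AccessScheme) :
    Measurable (N.dataPoached P wa) := by
  have hcoin : ∀ c a, MeasurableSet {ω | N.coin c ω < a} := fun c a =>
    measurableSet_lt (hN.measurable_coin c) measurable_const
  have hF := fun f => hN.sigmaOf_le _ _ (N.measurableSet_frame_eq P wa subset_rfl f)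
  have htier := fun t => hN.sigmaOf_le _ _ (N.measurableSet_assocEvent P subset_rfl t)
  have hpick : ∀ i, MeasurableSet {ω | N.uePicked P i ω} := fun i =>
    measurableSet_countable_choice (p := fun t ω => ω ∈ N.pickEvent t (.tagUePick i)) htier
      fun t => hN.sigmaOf_le Set.univ _
        (measurableSet_pickEvent (Set.mem_univ _) (Set.mem_univ _))
  refine measurable_countable_choice (h := fun f ω => ENNReal.ofReal (P.bw * P.T) *
    ∑ i ∈ Finset.Icc (f.Fa + 1) (f.Fa + f.Fbd), if N.poaches P i ω ∧ N.uePicked P i ω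
      then spectralEff (N.sinrAccess P wa f i ω) else 0) hF fun f => ?_
  refine (Finset.measurable_fun_sum _ fun i _ => Measurable.ite ?_ ?_ measurable_const).const_mul _
  · refine MeasurableSet.inter (MeasurableSet.inter (MeasurableSet.compl ?_) (hcoin _ _)) (hpick i)
    exact hN.sigmaOf_le Set.univ _
      (measurableSet_sbsScheduled (i := i) (Set.mem_univ _) (Set.mem_univ _))
  · exact measurable_spectralEff.comp ((@EnvMeasurable.measurable_sinrAccess _ (N.sigmaOf envSources)
      N (N.envMeasurable subset_rfl) P wa f i).mono (hN.sigmaOf_le envSources) le_rfl)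

/-- Mean access data of a UE served by an SBS, given the common subframe lengths. -/
lemma IsModel.meanDataSA_eq [IsProbabilityMeasure μ] (hN : N.IsModel P μ)
    (wa : AccessScheme) (wb : BackhaulScheme) (f : FrameLengths) :
    N.meanDataSA P μ wa wb f = N.formulaSA P μ wa wb f := by
  cases wb with
  | SAB => simp only [meanDataSA, dataSA, formulaSA, add_zero, hN.lintegral_dataAccess]
  | UAB =>
    simp only [meanDataSA, dataSA, formulaSA]
    rw [lintegral_add_right _ (hN.measurable_dataPoached wa), hN.lintegral_dataAccess,
      hN.lintegral_dataPoached]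

lemma IsModel.rateM_eq [IsProbabilityMeasure μ] (hN : N.IsModel P μ) (wa : AccessScheme) :
    N.rateM P μ wa = N.formulaM P μ wa := by
  have hF : (0 : ℝ) < P.F := by exact_mod_cast P.F_pos
  have hTF : 0 < P.T * P.F := mul_pos P.T_pos hF
  have h0 := bw_mul_T_div_log_nonneg P
  have hc : ENNReal.ofReal (P.bw / (P.F * Real.log 2)) =
      (ENNReal.ofReal (P.T * P.F))⁻¹ * ENNReal.ofReal (P.bw * P.T / Real.log 2) := by
    rw [← ENNReal.ofReal_inv_of_pos hTF, ← ENNReal.ofReal_mul (by positivity)]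
    congr 1
    have := P.T_pos.ne'
    field_simp
  rw [rateM, hN.lintegral_condTier wa, formulaM, hN.frameExp_eq, hN.frameExp_eq, div_eq_mul_inv,
    ← ENNReal.tsum_mul_right]
  refine tsum_congr fun f => ?_
  simp only [dataM, hN.lintegral_dataAccess, hc]
  ring

lemma IsModel.rateS_eq [IsProbabilityMeasure μ] (hN : N.IsModel P μ) (wa : AccessScheme)
    (wb : BackhaulScheme) : N.rateS P μ wa wb = N.formulaS P μ wa wb := by
  simp only [rateS, formulaS, hN.meanDataSA_eq, hN.meanDataSB_eq]

/-! ### Ergodic rates -/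

instance [IsProbabilityMeasure μ] (t : Tier) : IsFiniteMeasure (N.condTier P μ t) := by
  unfold condTier
  infer_instance

lemma IsModel.frameSigma_le (hN : N.IsModel P μ) (wa : AccessScheme) :
    N.frameSigma P wa ≤ ‹MeasurableSpace Ω› :=
  (measurable_iff_comap_le.1 (N.measurable_frame P wa subset_rfl)).trans (hN.sigmaOf_le _)

lemma IsModel.spatialSigma_le (hN : N.IsModel P μ) : N.spatialSigma ≤ ‹MeasurableSpace Ω› :=
  iSup_le fun _ => hN.measurable _

/-- Each event `frame = f` belongs to the conditioning σ-algebra, so the bound on the minimum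
applies on it separately, and summing over `f` keeps the minimum inside the frame average. -/
lemma IsModel.lintegral_min_condLExp_frame_le [IsProbabilityMeasure μ] (hN : N.IsModel P μ)
    (wa : AccessScheme) (wb : BackhaulScheme) :
    ∫⁻ ω, min
        (condLExp (N.spatialSigma ⊔ N.frameSigma P wa) (N.condTier P μ .s) (N.dataSA P wa wb) ω)
        (condLExp (N.spatialSigma ⊔ N.frameSigma P wa) (N.condTier P μ .s) (N.dataSB P wa wb) ω) /
        ENNReal.ofReal (P.T * P.F) ∂(N.condTier P μ .s) ≤ N.formulaS P μ wa wb := by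
  have hm : N.spatialSigma ⊔ N.frameSigma P wa ≤ ‹MeasurableSpace Ω› :=
    sup_le hN.spatialSigma_le (hN.frameSigma_le wa)
  have hTF : (ENNReal.ofReal (P.T * P.F))⁻¹ ≠ ∞ := by
    have : 0 < P.T * P.F := mul_pos P.T_pos (by exact_mod_cast P.F_pos)
    simpa using this
  simp only [div_eq_mul_inv]
  rw [lintegral_mul_const' _ _ hTF, formulaS, hN.lintegral_eq_tsum_frame wa, hN.frameExp_eq,
    ← ENNReal.tsum_mul_right]
  refine ENNReal.tsum_le_tsum fun f => ?_
  have hA : MeasurableSet[N.spatialSigma ⊔ N.frameSigma P wa] {ω | N.frame P wa ω = f} :=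
    (le_sup_right : N.frameSigma P wa ≤ N.spatialSigma ⊔ N.frameSigma P wa) _
      ⟨{f}, MeasurableSpace.measurableSet_top, rfl⟩
  refine (mul_le_mul_left (setLIntegral_min_condLExp_le hm _ _ _ hA) _).trans_eq ?_
  have hSA := hN.meanDataSA_eq wa wb f
  have hSB := hN.meanDataSB_eq wa wb f
  rw [meanDataSA] at hSA
  rw [meanDataSB] at hSB
  rw [hN.setLIntegral_condTier, hN.setLIntegral_condTier, hSA, hSB, ← mul_min, div_eq_mul_inv,
    mul_assoc]

/-- The frame is now averaged out by the conditioning, so the bound is applied on the whole space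
only and the minimum ends up outside the frame average. -/
lemma IsModel.lintegral_min_condLExp_spatial_le [IsProbabilityMeasure μ] (hN : N.IsModel P μ)
    (wa : AccessScheme) (wb : BackhaulScheme) :
    ∫⁻ ω, min (condLExp N.spatialSigma (N.condTier P μ .s) (N.dataSA P wa wb) ω)
        (condLExp N.spatialSigma (N.condTier P μ .s) (N.dataSB P wa wb) ω) /
        ENNReal.ofReal (P.T * P.F) ∂(N.condTier P μ .s) ≤ N.formulaSAveraged P μ wa wb := by
  have hTF : (ENNReal.ofReal (P.T * P.F))⁻¹ ≠ ∞ := by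
    have : 0 < P.T * P.F := mul_pos P.T_pos (by exact_mod_cast P.F_pos)
    simpa using this
  have h := setLIntegral_min_condLExp_le hN.spatialSigma_le (N.condTier P μ .s)
    (N.dataSA P wa wb) (N.dataSB P wa wb) MeasurableSet.univ
  simp only [setLIntegral_univ, hN.lintegral_condTier wa] at h
  simp only [div_eq_mul_inv, formulaSAveraged]
  rw [lintegral_mul_const' _ _ hTF]
  rw [← funext (hN.meanDataSA_eq wa wb), ← funext (hN.meanDataSB_eq wa wb)]
  refine mul_le_mul_left ?_ _
  rw [hN.lintegral_condTier wa]
  exact h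

end Network

end SelfBackhaul

theorem theorem3 {Ω : Type*} [MeasurableSpace Ω] (μ : MeasureTheory.Measure Ω)
    [MeasureTheory.IsProbabilityMeasure μ] (P : SelfBackhaul.Params)
    (N : SelfBackhaul.Network Ω) (hN : N.IsModel P μ)
    (wa : SelfBackhaul.AccessScheme) (wb : SelfBackhaul.BackhaulScheme) :
    -- the mean rate formula
    N.rateDL P μ wa wb =
        ENNReal.ofReal (N.assocProb P μ .m) * N.formulaM P μ wa
          + ENNReal.ofReal (N.assocProb P μ .s) * N.formulaS P μ wa wb ∧
    -- its ingredients
    N.assocProb P μ .m + N.assocProb P μ .s = 1 ∧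
    N.rateM P μ wa = N.formulaM P μ wa ∧
    N.rateS P μ wa wb = N.formulaS P μ wa wb ∧
    (∀ f : SelfBackhaul.FrameLengths,
      N.meanDataSA P μ wa wb f = N.formulaSA P μ wa wb f ∧
      N.meanDataSB P μ wa wb f = N.formulaSB P μ wa wb f) ∧
    -- the ergodic mean rates that the formula bounds from above
    N.ergodicRate P (N.spatialSigma ⊔ N.frameSigma P wa) μ wa wb ≤
        ENNReal.ofReal (N.assocProb P μ .m) * N.formulaM P μ wa
          + ENNReal.ofReal (N.assocProb P μ .s) * N.formulaS P μ wa wb ∧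
    N.ergodicRate P N.spatialSigma μ wa wb ≤
        ENNReal.ofReal (N.assocProb P μ .m) * N.formulaM P μ wa
          + ENNReal.ofReal (N.assocProb P μ .s) * N.formulaSAveraged P μ wa wb := by
  have hmean := hN.rateM_eq wa
  have hS := hN.rateS_eq wa wb
  refine ⟨?_, hN.assocProb_add, hmean, hS,
    fun f => ⟨hN.meanDataSA_eq wa wb f, hN.meanDataSB_eq wa wb f⟩, ?_, ?_⟩
  · rw [SelfBackhaul.Network.rateDL, hmean, hS]
  · rw [SelfBackhaul.Network.ergodicRate, hmean]
    gcongr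
    exact hN.lintegral_min_condLExp_frame_le wa wb
  · rw [SelfBackhaul.Network.ergodicRate, hmean]
    gcongr
    exact hN.lintegral_min_condLExp_spatial_le wa wb
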